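/- Let $U$ be a finite set, $(R,\oplus)$ a finite commutative group, let $n\ge1$, $s\ge0$, $k\ge1$ be integers and $0<\delta<1$, $\varepsilon>0$ reals, and write $[r]=\{0,\dots,r-1\}$. Let $c$ be an integer with $c\ge (s+2)/(k\delta)$ and $c=O((s+1)/\delta)$, and let $m,\ell$ be integers with $(1+\varepsilon)n\le m\le(1+\varepsilon)n+O(n^\delta)$ and $n^\delta\le\ell=O(n^\delta)$ (that is, $m=(1+\varepsilon)n$ and $\ell=n^\delta$ up to rounding). Let $\mathcal H_m,\mathcal H_\ell,\mathcal H_R$ be arbitrary finite families of functions from $U$ to $[m]$, $[\ell]$, $R$ that are $2k$-wise independent: for a random member, the values at any at most $2k$ distinct keys are independent and uniform. The data structure $\mathrm{DS}_n$ consists of independent uniformly random choices of: $f_1,f_2\in\mathcal H_m$; $g_1,\dots,g_c\in\mathcal H_\ell$; vectors $z^{(i)}_j\in[m]^\ell$ for $1\le j\le c$, $i\in\{1,2\}$; vectors $t_1,t_2\in R^m$; vectors $y_1,\dots,y_c\in R^\ell$; and $f\in\mathcal H_R$. Put $$h_i(x)=\Bigl(f_i(x)+\sum_{j=1}^c z^{(i)}_j[g_j(x)]\Bigr)\bmod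 m\quad(i=1,2),$$ $$h(x)=t_1[h_1(x)]\oplus t_2[h_2(x)]\oplus f(x)\oplus y_1[g_1(x)]\oplus\dots\oplus y_c[g_c(x)].$$ Then: (i) For each $S\subseteq U$ with $|S|=n$ there is an event $B_S$ of probability $O(1/n^{s+1})$ such that, conditioned on $\overline{B_S}$, the values $h(x)$, $x\in S$, are independent and uniform in $R$. The constant depends only on $\varepsilon,\delta,s,k,c$ and the constants implied in the assumptions on $c,m,\ell$, not on $n$, $U$, $R$, $S$, $m$, $\ell$ or the hash families. Suppose moreover that each member of the three hash families is described by $O(k)$ words (from $U$, $R$ or $[m]$) and can be evaluated from its description in $O(k)$ steps, on a unit-cost machine whose instructions are stack operations, indexed loads, $\oplus$, addition modulo a constant, and an arbitrary further set of binary word operations. Then $\mathrm{DS}_n$ can be stored in memory such that: (ii) For every $x\in U$, $h(x)$ is evaluated on this machine in time $O((s+1)/\delta)$; the constant depends only on $k$ and on the constants in the assumptions. (iii) $\mathrm{DS}_n$ comprises at most $2(1+\varepsilon)n+O((s+1)n^\delta)$ words from $R$ and $[m]$ together, and $O(s+1)$ words from $U$; the constants depend only on $\delta$, $k$ and the constants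 in the assumptions. -/

import Mathlib

universe u v w₁ w₂ w₃ w₄

/-- Probability of an event under the uniform distribution on a finite sample space. -/
noncomputable def unifProb {Ω : Type*} (E : Set Ω) : ℝ :=
  (E.ncard : ℝ) / (Nat.card Ω : ℝ)

/-! ### Hash families -/

/-- A finite (indexed) family of hash functions from `U` to `V`; a random member is obtained by
choosing the seed uniformly at random. -/
structure HashFamily.{a, b, d} (U : Type a) (V : Type b) where
  Seed : Type d
  finite : Finite Seed
  nonempty : Nonempty Seed
  fn : Seed → U → V

attribute [instance] HashFamily.finite HashFamily.nonempty

/-- `κ`-wise independence: the values at any at most `κ` distinct keys are uniform and independent.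
(If `U` has at least `κ` elements, it is equivalent to require this for exactly `κ` keys.) -/
def HashFamily.IsIndependent {U V : Type*} (H : HashFamily U V) (κ : ℕ) : Prop :=
  ∀ T : Finset U, T.card ≤ κ → ∀ v : U → V,
    unifProb {σ : H.Seed | ∀ x ∈ T, H.fn σ x = v x} = 1 / (Nat.card V : ℝ) ^ T.card

/-! ### The machine model

Memory consists of words from `U`, words from `R` and words from `[m]`.  A program is a sequence of
instructions that work on a stack of words; every instruction takes one step, so the running time
of a program is its length. The instruction set consists of stack manipulation, indexed loads, the
group operation of `R`, addition modulo a constant, and an arbitrary collection `Γ` of further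
binary word operations (these are what a hash family may use, e.g. field arithmetic). -/

/-- Machine words. -/
inductive HWord (U R : Type*) where
  | key (x : U)
  | val (a : R)
  | num (i : ℕ)

/-- Memory: arrays of words from `U`, from `R`, and from `[m]`. -/
structure HMem (U R : Type*) (m : ℕ) where
  keys : List U
  vals : List R
  nums : List (Fin m)

/-- Instructions. `b` is the base address of an indexed load, `q` a constant modulus. -/
inductive HInstr (U R Γ : Type*) where
  | push (w : HWord U R)
  | pick (i : ℕ)
  | swap
  | drop
  | loadKey (b : ℕ)
  | loadVal (b : ℕ)
  | loadNum (b : ℕ)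
  | addVal
  | addMod (q : ℕ)
  | extra (γ : Γ)

/-- Effect of one instruction on the stack; `none` means that the machine is stuck. -/
def HInstr.step {U R Γ : Type*} [Add R] {m : ℕ} (op : Γ → HWord U R → HWord U R → HWord U R)
    (M : HMem U R m) : HInstr U R Γ → List (HWord U R) → Option (List (HWord U R))
  | .push w, st => some (w :: st)
  | .pick i, st => (st[i]?).map (· :: st)
  | .swap, a :: b :: st => some (b :: a :: st)
  | .drop, _ :: st => some st
  | .loadKey b, .num i :: st => (M.keys[b + i]?).map (fun x => .key x :: st)
  | .loadVal b, .num i :: st => (M.vals[b + i]?).map (fun a => .val a :: st)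
  | .loadNum b, .num i :: st => (M.nums[b + i]?).map (fun j => .num j.val :: st)
  | .addVal, .val a :: .val b :: st => some (.val (b + a) :: st)
  | .addMod q, .num a :: .num b :: st => some (.num ((b + a) % q) :: st)
  | .extra γ, a :: b :: st => some (op γ b a :: st)
  | _, _ => none

/-- Execution of a program. -/
def hrun {U R Γ : Type*} [Add R] {m : ℕ} (op : Γ → HWord U R → HWord U R → HWord U R)
    (M : HMem U R m) : List (HInstr U R Γ) → List (HWord U R) → Option (List (HWord U R))
  | [], st => some st
  | i :: p, st => (i.step op M st).bind (hrun op M p)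

/-- The words of `D` are stored in `M` as contiguous blocks, starting at the addresses
`bk`, `bv`, `bn` of the three arrays. -/
def HMem.Holds {U R : Type*} {m : ℕ} (M : HMem U R m) (bk bv bn : ℕ) (D : HMem U R m) : Prop :=
  D.keys <+: M.keys.drop bk ∧ D.vals <+: M.vals.drop bv ∧ D.nums <+: M.nums.drop bn

/-- Every member of the family `H` has a description (of a fixed format) of at most `a` words, and
wherever this description is stored, the value at a key can be computed from it in at most `a`
steps. (`toWord` presents values as machine words.) -/
def HashFamily.HasCost {U R V Γ : Type*} [Add R] (m : ℕ)
    (op : Γ → HWord U R → HWord U R → HWord U R)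
    (H : HashFamily U V) (toWord : V → HWord U R) (a : ℕ) : Prop :=
  ∃ (nk nv nn : ℕ) (desc : H.Seed → HMem U R m) (prog : ℕ → ℕ → ℕ → List (HInstr U R Γ)),
    nk + nv + nn ≤ a ∧
    (∀ σ, (desc σ).keys.length = nk ∧ (desc σ).vals.length = nv ∧ (desc σ).nums.length = nn) ∧
    ∀ bk bv bn, (prog bk bv bn).length ≤ a ∧
      ∀ (σ : H.Seed) (M : HMem U R m), M.Holds bk bv bn (desc σ) →
        ∀ (x : U) (st : List (HWord U R)),
          hrun op M (prog bk bv bn) (.key x :: st) = some (toWord (H.fn σ x) :: st)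

/-! ### The construction -/

section Construction

variable {U R : Type*} {m l : ℕ}

/-- The components `f₁, f₂`, `g₁, …, g_c` and `z_j^{(i)} ∈ [m]^l` of a pair in the class `Z`,
where `f₁, f₂` come from `Hm` and the `g_j` from `Hl`. -/
structure PairSeed (Hm : HashFamily U (Fin m)) (Hl : HashFamily U (Fin l)) (c : ℕ) where
  f : Fin 2 → Hm.Seed
  g : Fin c → Hl.Seed
  z : Fin 2 → Fin c → Fin l → Fin m

/-- `h_i(x) = (f_i(x) + ∑_j z_j^{(i)}[g_j(x)]) mod m`. -/
def PairSeed.hash {Hm : HashFamily U (Fin m)} {Hl : HashFamily U (Fin l)} {c : ℕ}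
    (p : PairSeed Hm Hl c) (i : Fin 2) (x : U) : Fin m :=
  ⟨((Hm.fn (p.f i) x).val + ∑ j : Fin c, (p.z i j (Hl.fn (p.g j) x)).val) % m,
    Nat.mod_lt _ (Hm.fn (p.f i) x).pos⟩

/-- The random choices of the data structure: a pair `(h₁, h₂)`, tables `t₁, t₂ ∈ R^m`, tables
`y₁, …, y_c ∈ R^l`, and a function `f` from `HR`. -/
structure DSSeed (Hm : HashFamily U (Fin m)) (Hl : HashFamily U (Fin l)) (HR : HashFamily U R)
    (c : ℕ) where
  pair : PairSeed Hm Hl c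
  t : Fin 2 → Fin m → R
  y : Fin c → Fin l → R
  f : HR.Seed

instance {Hm : HashFamily U (Fin m)} {Hl : HashFamily U (Fin l)} {c : ℕ} :
    Finite (PairSeed Hm Hl c) :=
  Finite.of_injective (fun p => (p.f, p.g, p.z)) (by
    rintro ⟨a, b, d⟩ ⟨a', b', d'⟩ h
    simpa using h)

/-- The sample space is finite. -/
instance [Finite R] {Hm : HashFamily U (Fin m)} {Hl : HashFamily U (Fin l)}
    {HR : HashFamily U R} {c : ℕ} : Finite (DSSeed Hm Hl HR c) :=
  Finite.of_injective (fun p => (p.pair, p.t, p.y, p.f)) (by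
    rintro ⟨a, b, d, e⟩ ⟨a', b', d', e'⟩ h
    simpa using h)

/-- `h(x) = t₁[h₁(x)] ⊕ t₂[h₂(x)] ⊕ f(x) ⊕ y₁[g₁(x)] ⊕ … ⊕ y_c[g_c(x)]`. -/
def DSSeed.hash [AddCommGroup R] {Hm : HashFamily U (Fin m)} {Hl : HashFamily U (Fin l)}
    {HR : HashFamily U R} {c : ℕ} (ω : DSSeed Hm Hl HR c) (x : U) : R :=
  ω.t 0 (ω.pair.hash 0 x) + ω.t 1 (ω.pair.hash 1 x) + HR.fn ω.f x
    + ∑ j : Fin c, ω.y j (Hl.fn (ω.pair.g j) x)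

end Construction

/-!
Regard every key `x ∈ S` as an edge between the vertices `h₁(x)` and `h₂(x)` of a bipartite graph
with two sides of `m` vertices. If `T ⊆ S` has a function `g j` that loses at most `k` keys of `T`
to collisions (`defect (g j) T ≤ k`), then at most `2k` keys of `T` collide under `g j`; these are
covered by the `2k`-wise independence of `f`, and each other key has an entry of `y j` of its own.
Hence `h` is uniform on `T` (`uniformOn_of_defect_le`), and by the same argument, with the tables
`z j` in place of `y j`, the pair `(h₁, h₂)` is uniform on `T` given all the `g j`. The keys outside
the 2-core of the graph can be peeled off at leaves, where they have an entry of `t₁` or `t₂` of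
their own. So `h` is uniform on `S` unless some leafless subgraph has more than `k` collisions under
every `g j`; this is the bad event (`PairSeed.uniformOn_of_not_isBad`).

To bound its probability, edges of such a leafless subgraph are removed one by one, always keeping
at most two leaves (`exists_critical_subgraph`), until some `g j` has at most `k` collisions and the
number of edges exceeds the number of vertices by at most `K = s + 1`. At that moment either every
`g j` still has at least `k` collisions, which has probability at most `(t² / l)^(kc)` for a set of
`t` keys, or the excess is exactly `K`; and in both cases `(h₁, h₂)` is uniform on the set.
The bound on the excess matters: without it, for small `ε` the expected number of leafless
subgraphs is exponentially large. With it all but boundedly many degrees are equal to two, and the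
exponential formula (`sum_prod_weight_fibreCard_le`), with weights that favour this degree, shows
that there are at most `m ^ v * t! * poly(t)` such graphs with `t` edges and `v` vertices
(`card_graphs_le`). The union bound over all sets of keys then leads to the series
`∑ poly(t) * (n / m) ^ t`, which converges since `n / m ≤ 1 / (1 + ε)`
(`PairSeed.unifProb_isBad_le`).

For storage and evaluation, the descriptions and tables are placed one after the other
(`exists_layout`), and a straight-line program computes `h₁(x)` and `h₂(x)`, looks up `t₁` and `t₂`,
and adds `f(x)` and the entries of the tables `y j` (`hrun_dsProg`).
-/

/-! ### Uniform probability on finite sample spaces -/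

theorem unifProb_nonneg {Ω : Type*} (E : Set Ω) : 0 ≤ unifProb E := by
  unfold unifProb; positivity

theorem unifProb_mono {Ω : Type*} [Finite Ω] {E F : Set Ω} (h : E ⊆ F) :
    unifProb E ≤ unifProb F := by
  unfold unifProb
  gcongr
  exact F.toFinite

theorem unifProb_univ {Ω : Type*} [Finite Ω] [Nonempty Ω] :
    unifProb (Set.univ : Set Ω) = 1 := by
  unfold unifProb
  rw [Set.ncard_univ]
  exact div_self (by exact_mod_cast Nat.card_pos.ne')

theorem unifProb_preimage_equiv {Ω Ω' : Type*} (e : Ω ≃ Ω') (E : Set Ω') :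
    unifProb (e ⁻¹' E) = unifProb E := by
  unfold unifProb
  rw [Nat.card_congr e, ← Set.ncard_image_of_injective _ e.injective,
    Set.image_preimage_eq _ e.surjective]

theorem unifProb_le_sum {Ω ι : Type*} [Finite Ω] (I : Finset ι) (F : ι → Set Ω) {E : Set Ω}
    (h : ∀ ω ∈ E, ∃ i ∈ I, ω ∈ F i) : unifProb E ≤ ∑ i ∈ I, unifProb (F i) := by
  unfold unifProb
  rw [← Finset.sum_div]
  gcongr
  have h1 : E ⊆ ⋃ i ∈ I, F i := fun ω hω => by
    obtain ⟨i, hi, h⟩ := h ω hω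
    exact Set.mem_biUnion hi h
  have h2 := (Set.ncard_le_ncard h1 (Set.toFinite _)).trans (Finset.set_ncard_biUnion_le I F)
  exact_mod_cast h2

theorem unifProb_union_le {Ω : Type*} [Finite Ω] (E F : Set Ω) :
    unifProb (E ∪ F) ≤ unifProb E + unifProb F := by
  unfold unifProb
  rw [← add_div]
  gcongr
  exact_mod_cast Set.ncard_union_le E F

/-- Law of total probability: an event in a product, conditioned on the first component. -/
theorem unifProb_prod {α β : Type*} [Fintype α] [Finite β] (E : Set (α × β)) :
    unifProb E = (∑ a, unifProb {b | (a, b) ∈ E}) / Nat.card α := by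
  unfold unifProb
  have h : E.ncard = ∑ a, {b | (a, b) ∈ E}.ncard := by
    have e : E ≃ Σ a, {b | (a, b) ∈ E} :=
      { toFun := fun p => ⟨p.1.1, p.1.2, p.2⟩
        invFun := fun p => ⟨(p.1, p.2.1), p.2.2⟩
        left_inv := fun _ => rfl
        right_inv := fun _ => rfl }
    have := Nat.card_congr e
    rw [Nat.card_sigma] at this
    simpa only [Nat.card_coe_set_eq] using this
  rw [← Finset.sum_div, Nat.card_prod, h, div_div]
  push_cast
  rw [mul_comm (Nat.card β : ℝ)]

theorem unifProb_prod_eq {α β : Type*} [Finite α] [Finite β] {E : Set (α × β)} {G : Set α}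
    {q : ℝ} (h1 : ∀ a ∈ G, unifProb {b | (a, b) ∈ E} = q) (h0 : ∀ a ∉ G, ∀ b, (a, b) ∉ E) :
    unifProb E = unifProb G * q := by
  classical
  have := Fintype.ofFinite α
  have h : ∀ a, unifProb {b | (a, b) ∈ E} = if a ∈ G then q else 0 := by
    intro a
    split_ifs with ha
    · exact h1 a ha
    · simp [h0 a ha, unifProb]
  rw [unifProb_prod]
  simp_rw [h]
  rw [← Finset.sum_filter, Finset.sum_const, nsmul_eq_mul, unifProb, Set.ncard_eq_toFinset_card',
    Set.toFinset_card, Fintype.card_subtype]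
  ring

theorem unifProb_prod_le {α β : Type*} [Finite α] [Finite β] {E : Set (α × β)} {G : Set α}
    {q : ℝ} (h1 : ∀ a ∈ G, unifProb {b | (a, b) ∈ E} ≤ q) (h0 : ∀ a ∉ G, ∀ b, (a, b) ∉ E) :
    unifProb E ≤ unifProb G * q := by
  classical
  have := Fintype.ofFinite α
  have h : ∀ a, unifProb {b | (a, b) ∈ E} ≤ if a ∈ G then q else 0 := by
    intro a
    split_ifs with ha
    · exact h1 a ha
    · simp [h0 a ha, unifProb]
  rw [unifProb_prod]
  refine (div_le_div_of_nonneg_right (Finset.sum_le_sum fun a _ => h a)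
    (by positivity)).trans_eq ?_
  rw [← Finset.sum_filter, Finset.sum_const, nsmul_eq_mul, unifProb, Set.ncard_eq_toFinset_card',
    Set.toFinset_card, Fintype.card_subtype]
  ring

theorem unifProb_prod_const {α β : Type*} [Finite α] [Nonempty α] [Finite β] {E : Set (α × β)}
    {q : ℝ} (h : ∀ a, unifProb {b | (a, b) ∈ E} = q) : unifProb E = q := by
  rw [unifProb_prod_eq (G := Set.univ) (fun a _ => h a) (by simp), unifProb_univ, one_mul]

theorem unifProb_fst {α β : Type*} [Finite α] [Finite β] [Nonempty β] (G : Set α) :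
    unifProb {p : α × β | p.1 ∈ G} = unifProb G := by
  rw [unifProb_prod_eq (G := G) (q := 1) _ (by simp), mul_one]
  intro a ha
  simp [ha, unifProb_univ]

theorem unifProb_pi {ι α : Type*} [Fintype ι] [Finite α] (E : ι → Set α) :
    unifProb {f : ι → α | ∀ i, f i ∈ E i} = ∏ i, unifProb (E i) := by
  unfold unifProb
  have h : {f : ι → α | ∀ i, f i ∈ E i}.ncard = ∏ i, (E i).ncard := by
    have e := Nat.card_congr (Equiv.Set.univPi E)
    rw [Nat.card_pi] at e
    simp only [Nat.card_coe_set_eq] at e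
    rw [← e]
    congr 1
    ext f
    simp
  rw [h, Nat.card_pi]
  push_cast
  rw [Finset.prod_div_distrib]

/-! ### Random functions that are uniform on a set of keys -/

/-- The random function `F` (with randomness `ω : Ω`) has independent and uniform values on `T`. -/
def UniformOn {Ω U A : Type*} (F : Ω → U → A) (T : Finset U) : Prop :=
  ∀ v : U → A, unifProb {ω | ∀ x ∈ T, F ω x = v x} = 1 / (Nat.card A : ℝ) ^ T.card

/-- If for every `a` the sample space can be permuted so that the value at `x` is shifted by `a`
and the values on `T` stay unchanged, then uniformity extends from `T` to `T ∪ {x}`. -/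
theorem UniformOn.insert_of_shift {Ω U A : Type*} [DecidableEq U] [Finite Ω] [AddGroup A]
    [Finite A] {F : Ω → U → A} {T : Finset U} {x : U} (hT : UniformOn F T) (hx : x ∉ T)
    (shift : A → Ω → Ω) (hinj : ∀ a, Function.Injective (shift a))
    (hshift : ∀ a ω, F (shift a ω) x = F ω x + a)
    (hfix : ∀ a ω, ∀ x' ∈ T, F (shift a ω) x' = F ω x') : UniformOn F (insert x T) := by
  intro v
  have := Fintype.ofFinite A
  let N : A → Set Ω := fun a => {ω | (∀ x' ∈ T, F ω x' = v x') ∧ F ω x = a}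
  have hle : ∀ a b, (N a).ncard ≤ (N b).ncard := by
    intro a b
    refine Set.ncard_le_ncard_of_injOn (shift (-a + b)) ?_ ((hinj _).injOn) (Set.toFinite _)
    rintro ω ⟨h1, h2⟩
    refine ⟨fun x' hx' => (hfix _ _ x' hx').trans (h1 x' hx'), ?_⟩
    rw [hshift, h2, add_neg_cancel_left]
  have hsum : {ω | ∀ x' ∈ T, F ω x' = v x'}.ncard = ∑ a, (N a).ncard := by
    have e : {ω | ∀ x' ∈ T, F ω x' = v x'} ≃ Σ a, N a :=
      { toFun := fun ω => ⟨F ω.1 x, ω.1, ω.2, rfl⟩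
        invFun := fun p => ⟨p.2.1, p.2.2.1⟩
        left_inv := fun _ => rfl
        right_inv := by rintro ⟨a, ω, h1, rfl⟩; rfl }
    have := Nat.card_congr e
    rw [Nat.card_sigma] at this
    simpa only [Nat.card_coe_set_eq] using this
  have hall : ∑ a, (N a).ncard = Nat.card A * (N (v x)).ncard := by
    rw [Finset.sum_congr rfl fun a _ => (hle a (v x)).antisymm (hle (v x) a), Finset.sum_const,
      Finset.card_univ, Nat.card_eq_fintype_card, smul_eq_mul]
  have hN : {ω | ∀ x' ∈ insert x T, F ω x' = v x'} = N (v x) := by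
    ext ω
    simp only [N, Finset.forall_mem_insert, Set.mem_ofPred_eq]
    exact and_comm
  have h := hT v
  have hA : (Nat.card A : ℝ) ≠ 0 := by exact_mod_cast Nat.card_pos.ne'
  rw [unifProb, hsum, hall] at h
  rw [hN, unifProb, Finset.card_insert_of_notMem hx, pow_succ, ← div_div, ← h]
  push_cast
  field_simp

/-- The restriction of `F` to `T` is a uniformly random function on `T`. -/
theorem UniformOn.unifProb_restrict {Ω U A : Type*} [Finite Ω] [Finite A] {F : Ω → U → A}
    {T : Finset U} (hT : UniformOn F T) (P : Set (T → A)) :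
    unifProb {ω | (fun x : T => F ω x) ∈ P} ≤ P.ncard / (Nat.card A : ℝ) ^ T.card := by
  classical
  rcases isEmpty_or_nonempty Ω with h | ⟨⟨ω₀⟩⟩
  · simp only [unifProb, Nat.card_of_isEmpty, Nat.cast_zero, div_zero]
    positivity
  have h1 : ∀ φ : T → A, unifProb {ω | (fun x : T => F ω x) = φ}
      = 1 / (Nat.card A : ℝ) ^ T.card := by
    intro φ
    rw [← hT fun x => if hx : x ∈ T then φ ⟨x, hx⟩ else F ω₀ x]
    congr 1
    ext ω
    simp only [Set.mem_ofPred_eq, funext_iff, Subtype.forall]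
    exact forall₂_congr fun x hx => by simp [hx]
  refine (unifProb_le_sum P.toFinite.toFinset (fun φ => {ω | (fun x : T => F ω x) = φ})
    fun ω hω => ⟨_, by simpa using hω, rfl⟩).trans_eq ?_
  simp only [h1]
  rw [Finset.sum_const, nsmul_eq_mul, ← Set.ncard_eq_toFinset_card, mul_one_div]

/-! ### Counting functions by the sizes of their fibres -/

open Finset in
/-- The number of elements of `T` that `h` maps to `b`: the degree of the vertex `b`, if the keys
`x ∈ T` are regarded as edges with an endpoint `h x`. -/
def fibreCard {U V : Type*} [DecidableEq V] (h : U → V) (T : Finset U) (b : V) : ℕ :=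
  #{x ∈ T | h x = b}

/-- The exponential formula: there are `t! / ∏ b, (k b)!` functions on a set of `t` elements with
fibres of sizes `k b`, so a sum of products of weights of fibre sizes is `t!` times a coefficient
of a power of the exponential generating function of the weights. That coefficient is at most the
power of the whole sum. -/
theorem sum_prod_weight_fibreCard_le {α V : Type*} [Fintype α] [DecidableEq α] [Fintype V]
    [DecidableEq V] (u : ℕ → ℝ) (hu : ∀ i, 0 ≤ u i) :
    ∑ φ : α → V, ∏ b, u (fibreCard φ Finset.univ b)
      ≤ (Fintype.card α).factorial *
        (∑ i ∈ Finset.range (Fintype.card α + 1), u i / (i.factorial : ℝ)) ^ Fintype.card V := by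
  classical
  set t := Fintype.card α
  -- the linear functional sending the monomial with exponents `k` to `∏ b, u (k b)`
  let L : MvPolynomial V ℝ →ₗ[ℝ] ℝ :=
    (MvPolynomial.basisMonomials V ℝ).constr ℝ fun k => ∏ b, u (k b)
  have hL : ∀ k, L (MvPolynomial.monomial k 1) = ∏ b, u (k b) := fun k => by
    have := (MvPolynomial.basisMonomials V ℝ).constr_basis ℝ (fun k => ∏ b, u (k b)) k
    simpa using this
  have h1 : L ((∑ b : V, MvPolynomial.X b) ^ t)
      = ∑ φ : α → V, ∏ b, u (fibreCard φ Finset.univ b) := by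
    have e : (∑ b : V, MvPolynomial.X b : MvPolynomial V ℝ) ^ t
        = ∑ φ : α → V, MvPolynomial.monomial (∑ i, Finsupp.single (φ i) 1) 1 := by
      rw [← Fintype.piFinset_univ, show t = (Finset.univ : Finset α).card from rfl,
        ← Finset.prod_const, Finset.prod_univ_sum]
      refine Finset.sum_congr rfl fun φ _ => ?_
      simp only [MvPolynomial.X]
      rw [MvPolynomial.monomial_sum_one]
    rw [e, map_sum]
    refine Finset.sum_congr rfl fun φ _ => ?_
    rw [hL]
    refine Finset.prod_congr rfl fun b _ => ?_
    congr 1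
    rw [Finsupp.finsetSum_apply, fibreCard, Finset.card_filter]
    exact Finset.sum_congr rfl fun i _ => by rw [Finsupp.single_apply]
  have h2 : L ((∑ b : V, MvPolynomial.X b) ^ t)
      = ∑ k ∈ Finset.piAntidiag (Finset.univ : Finset V) t,
        (t.factorial : ℝ) * ∏ b, u (k b) / (k b).factorial := by
    rw [Finset.sum_pow_eq_sum_piAntidiag, map_sum]
    refine Finset.sum_congr rfl fun k hk => ?_
    have e : (∏ b, MvPolynomial.X b ^ k b : MvPolynomial V ℝ)
        = MvPolynomial.monomial (Finsupp.equivFunOnFinite.symm k) 1 := by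
      rw [MvPolynomial.monomial_eq, MvPolynomial.C_1, one_mul, Finsupp.prod_fintype _ _ (by simp)]
      rfl
    rw [e, ← nsmul_eq_mul, map_nsmul, hL, nsmul_eq_mul, Finset.prod_div_distrib]
    have hs := Nat.multinomial_spec Finset.univ k
    rw [(Finset.mem_piAntidiag.1 hk).1] at hs
    have h0 : (∏ b, ((k b).factorial : ℝ)) ≠ 0 :=
      Finset.prod_ne_zero_iff.2 fun b _ => by exact_mod_cast (k b).factorial_ne_zero
    rw [← hs]
    push_cast
    simp only [Finsupp.equivFunOnFinite_symm_apply_apply]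
    field_simp
  rw [← h1, h2, ← Finset.mul_sum, ← Finset.card_univ (α := V), ← Finset.prod_const,
    Finset.prod_univ_sum]
  gcongr
  · exact fun k _ _ => Finset.prod_nonneg fun b _ => div_nonneg (hu _) (Nat.cast_nonneg _)
  intro k hk
  rw [Fintype.mem_piFinset]
  intro b
  rw [Finset.mem_range, Nat.lt_succ_iff, ← (Finset.mem_piAntidiag.1 hk).1]
  exact Finset.single_le_sum (f := k) (fun _ _ => Nat.zero_le _) (Finset.mem_univ b)

/-- A weak form of Stirling's upper bound. -/
theorem factorial_mul_exp_le (t : ℕ) (ht : 1 ≤ t) :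
    (t.factorial : ℝ) * Real.exp t ≤ Real.exp 1 * t * (t : ℝ) ^ t := by
  obtain ⟨n, rfl⟩ := Nat.exists_eq_add_of_le' ht
  have h := Stirling.stirlingSeq'_antitone (Nat.zero_le n)
  simp only [Function.comp, Nat.succ_eq_add_one, zero_add, Stirling.stirlingSeq_one] at h
  rw [Stirling.stirlingSeq, div_le_iff₀ (by positivity), div_pow, ← Real.exp_nat_mul, mul_one,
    Real.sqrt_mul (by norm_num)] at h
  have h2 : √((n + 1 : ℕ) : ℝ) ≤ ((n + 1 : ℕ) : ℝ) := by
    rw [Real.sqrt_le_left (by positivity)]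
    have : (1 : ℝ) ≤ ((n + 1 : ℕ) : ℝ) := by exact_mod_cast ht
    nlinarith
  have h3 : (0 : ℝ) < √2 := by positivity
  calc ((n + 1).factorial : ℝ) * Real.exp ((n + 1 : ℕ) : ℝ)
      ≤ Real.exp 1 / √2 * (√2 * √((n + 1 : ℕ) : ℝ) * (((n + 1 : ℕ) : ℝ) ^ (n + 1)
          / Real.exp ((n + 1 : ℕ) : ℝ))) * Real.exp ((n + 1 : ℕ) : ℝ) := by gcongr
    _ = Real.exp 1 * √((n + 1 : ℕ) : ℝ) * ((n + 1 : ℕ) : ℝ) ^ (n + 1) := by field_simp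
    _ ≤ _ := by gcongr

open Finset in
/-- The number of vertices that are met by the edges in `T`. -/
def vertexCount {U V : Type*} [Fintype V] [DecidableEq V] (h : U → V) (T : Finset U) : ℕ :=
  #{b | fibreCard h T b ≠ 0}

open Finset in
/-- The number of vertices of degree one. -/
def leafCount {U V : Type*} [Fintype V] [DecidableEq V] (h : U → V) (T : Finset U) : ℕ :=
  #{b | fibreCard h T b = 1}

open Finset in
theorem sum_fibreCard {U V : Type*} [Fintype V] [DecidableEq V] (h : U → V) (T : Finset U) :
    ∑ b, fibreCard h T b = #T :=
  (card_eq_sum_card_fiberwise fun x _ => mem_univ (h x)).symm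

open Finset in
theorem two_mul_vertexCount_add {U V : Type*} [Fintype V] [DecidableEq V] (h : U → V)
    (T : Finset U) :
    2 * vertexCount h T + ∑ b, (fibreCard h T b - 2) = #T + leafCount h T := by
  rw [← sum_fibreCard h T, vertexCount, leafCount, card_filter, card_filter, mul_sum,
    ← sum_add_distrib, ← sum_add_distrib]
  refine sum_congr rfl fun b _ => ?_
  split_ifs <;> omega

/-- Weights of vertex degrees: a factor `1/m` for each vertex, a factor `t` for each vertex that is
not a leaf, and a factor `1/t` for each edge beyond the second. They make degree two dominant: the
generating function of the weights of `m` vertices is about `(1 + t / (2 * m)) ^ m`, up to a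
constant factor, which is the right order for graphs in which `t / 2` vertices have degree two. -/
noncomputable def degreeWeight (m t d : ℕ) : ℝ :=
  (1 / m) ^ (if d ≠ 0 then 1 else 0) * t ^ (if 2 ≤ d then 1 else 0) * (1 / t) ^ (d - 2)

open Finset in
theorem prod_degreeWeight {U V : Type*} [Fintype V] [DecidableEq V] (m t : ℕ) (h : U → V)
    (T : Finset U) :
    ∏ b, degreeWeight m t (fibreCard h T b)
      = (1 / m : ℝ) ^ vertexCount h T * (t : ℝ) ^ (vertexCount h T - leafCount h T)
        * (1 / t : ℝ) ^ ∑ b, (fibreCard h T b - 2) := by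
  have h1 : vertexCount h T - leafCount h T = ∑ b, if 2 ≤ fibreCard h T b then 1 else 0 := by
    rw [Nat.sub_eq_iff_eq_add, vertexCount, leafCount, card_filter, card_filter, ← sum_add_distrib]
    · refine sum_congr rfl fun b _ => ?_
      split_ifs <;> omega
    · refine card_le_card fun b => ?_
      simp only [mem_filter, mem_univ, true_and]
      omega
  rw [h1, vertexCount, card_filter, ← prod_pow_eq_pow_sum, ← prod_pow_eq_pow_sum,
    ← prod_pow_eq_pow_sum, ← prod_mul_distrib, ← prod_mul_distrib]
  rfl

theorem degreeWeight_nonneg (m t d : ℕ) : 0 ≤ degreeWeight m t d := by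
  unfold degreeWeight; positivity

theorem sum_degreeWeight_div_factorial_le (m t : ℕ) (hm : 1 ≤ m) (ht : 1 ≤ t) :
    ∑ i ∈ Finset.range (t + 1), degreeWeight m t i / (i.factorial : ℝ)
      ≤ 1 + (t / 2 + 2) / m := by
  have hm' : (0 : ℝ) < m := by exact_mod_cast hm
  have ht' : (1 : ℝ) ≤ t := by exact_mod_cast ht
  have hnn : ∀ i, 0 ≤ degreeWeight m t i / (i.factorial : ℝ) := fun i =>
    div_nonneg (degreeWeight_nonneg m t i) (by positivity)
  have htail : ∀ j, degreeWeight m t (j + 3) / ((j + 3).factorial : ℝ)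
      ≤ 1 / m * (1 / 2) ^ (j + 1) := by
    intro j
    have e1 : degreeWeight m t (j + 3) ≤ 1 / m := by
      simp only [degreeWeight, show j + 3 - 2 = j + 1 by omega]
      rw [if_pos (by omega), if_pos (by omega), pow_one, pow_one, pow_succ]
      have : (1 / t : ℝ) ^ j ≤ 1 := pow_le_one₀ (by positivity) (by
        rw [div_le_one (by positivity)]; exact ht')
      calc (1 / m * t * ((1 / t) ^ j * (1 / t)) : ℝ) = 1 / m * (1 / t) ^ j := by field_simp
        _ ≤ 1 / m * 1 := by gcongr
        _ = 1 / m := mul_one _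
    have e2 : (2 : ℝ) ^ (j + 1) ≤ ((j + 3).factorial : ℝ) := by
      have h2 : 2 ^ (j + 1) ≤ (j + 3).factorial := by
        have h1 := Nat.factorial_mul_pow_le_factorial (m := 1) (n := j + 2)
        rw [Nat.factorial_one, one_mul, show 1 + (j + 2) = j + 3 by omega] at h1
        exact (Nat.pow_le_pow_right (by norm_num) (by omega)).trans h1
      exact_mod_cast h2
    rw [div_eq_mul_inv]
    rw [one_div_pow, one_div (2 ^ (j + 1) : ℝ)]
    gcongr
  calc ∑ i ∈ Finset.range (t + 1), degreeWeight m t i / (i.factorial : ℝ)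
      ≤ ∑ i ∈ Finset.range (t + 3), degreeWeight m t i / (i.factorial : ℝ) :=
        Finset.sum_le_sum_of_subset_of_nonneg (by simp) fun i _ _ => hnn i
    _ = ∑ j ∈ Finset.range t, degreeWeight m t (j + 3) / ((j + 3).factorial : ℝ)
          + (1 + 1 / m + t / m / 2) := by
        rw [Finset.sum_range_succ', Finset.sum_range_succ', Finset.sum_range_succ']
        norm_num [degreeWeight]
        ring
    _ ≤ ∑ j ∈ Finset.range t, 1 / m * (1 / 2 : ℝ) ^ (j + 1) + (1 + 1 / m + t / m / 2) := by
        gcongr with j _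
        exact htail j
    _ ≤ 1 / m + (1 + 1 / m + t / m / 2) := by
        gcongr
        rw [← Finset.mul_sum]
        refine mul_le_of_le_one_right (by positivity) ?_
        simp_rw [pow_succ]
        rw [← Finset.sum_mul]
        have := sum_geometric_two_le t
        linarith
    _ = _ := by field_simp; ring

/-- The number of labelled bipartite graphs with `t` edges, two sides of `m` vertices, at most two
leaves and at least `t - K` vertices. If `m ^ v ≤ M` for the number `v` of vertices of all these
graphs, then up to a power of `t` there are at most `M * t!` of them. -/
theorem card_graphs_le {α : Type*} [Fintype α] [DecidableEq α] (m t K : ℕ) (hm : 1 ≤ m)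
    (ht : 1 ≤ t) (hα : Fintype.card α = t) (M : ℝ) (hM0 : 0 < M)
    (P : Set (α → Fin 2 → Fin m))
    (hleaf : ∀ φ ∈ P, ∑ i, leafCount (fun x => φ x i) Finset.univ ≤ 2)
    (hK : ∀ φ ∈ P, t ≤ ∑ i, vertexCount (fun x => φ x i) Finset.univ + K)
    (hM : ∀ φ ∈ P, (m : ℝ) ^ ∑ i, vertexCount (fun x => φ x i) Finset.univ ≤ M) :
    (P.ncard : ℝ) ≤ Real.exp 5 * M * (t : ℝ) ^ (3 * K + 5) * t.factorial := by
  classical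
  have hm' : (0 : ℝ) < m := by exact_mod_cast hm
  have ht' : (1 : ℝ) ≤ t := by exact_mod_cast ht
  have ht0 : (0 : ℝ) < t := by linarith
  let W : (α → Fin 2 → Fin m) → ℝ := fun φ =>
    ∏ i, ∏ b, degreeWeight m t (fibreCard (fun x => φ x i) Finset.univ b)
  have hW0 : ∀ φ, 0 ≤ W φ := fun φ =>
    Finset.prod_nonneg fun i _ => Finset.prod_nonneg fun b _ => degreeWeight_nonneg m t _
  -- the total weight factorizes over the two sides
  have hsum : ∑ φ, W φ ≤ (t.factorial * Real.exp (t / 2 + 2)) ^ 2 := by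
    have e : ∑ φ, W φ = (∑ ψ : α → Fin m, ∏ b, degreeWeight m t (fibreCard ψ Finset.univ b)) ^ 2 := by
      rw [← Fintype.sum_equiv (Equiv.piComm fun (_ : Fin 2) (_ : α) => Fin m)
        (fun ψ => ∏ i, ∏ b, degreeWeight m t (fibreCard (ψ i) Finset.univ b)) W fun ψ => rfl]
      rw [← Fintype.piFinset_univ, ← Fintype.card_fin 2, ← Finset.card_univ, ← Finset.prod_const,
        Finset.prod_univ_sum, Fintype.piFinset_univ]
      rfl
    rw [e]
    refine pow_le_pow_left₀ (Finset.sum_nonneg fun ψ _ => Finset.prod_nonneg fun b _ =>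
      degreeWeight_nonneg m t _) ?_ 2
    refine (sum_prod_weight_fibreCard_le _ (degreeWeight_nonneg m t)).trans ?_
    rw [hα, Fintype.card_fin]
    gcongr
    calc _ ≤ (1 + (t / 2 + 2) / m : ℝ) ^ m := by
          refine pow_le_pow_left₀ (Finset.sum_nonneg fun i _ => div_nonneg
            (degreeWeight_nonneg m t i) (by positivity)) ?_ m
          exact sum_degreeWeight_div_factorial_le m t hm ht
      _ ≤ Real.exp ((t / 2 + 2) / m) ^ m := by
          gcongr
          rw [add_comm]
          exact Real.add_one_le_exp _
      _ = Real.exp (t / 2 + 2) := by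
          rw [← Real.exp_nat_mul]
          congr 1
          field_simp
  -- each graph in `P` has a large weight
  have hlow : ∀ φ ∈ P, (t : ℝ) ^ t ≤ W φ * (M * (t : ℝ) ^ (3 * K + 4)) := by
    intro φ hφ
    have h2 : ∑ i, leafCount (fun x => φ x i) Finset.univ ≤ 2 := hleaf φ hφ
    have h3 := hK φ hφ
    have h4 := hM φ hφ
    have e0 := two_mul_vertexCount_add (fun x => φ x 0) Finset.univ
    have e1 := two_mul_vertexCount_add (fun x => φ x 1) Finset.univ
    simp only [Finset.card_univ, hα] at e0 e1
    simp only [W, Fin.prod_univ_two, Fin.sum_univ_two, prod_degreeWeight] at h2 h3 h4 ⊢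
    set v0 := vertexCount (fun x => φ x 0) Finset.univ
    set v1 := vertexCount (fun x => φ x 1) Finset.univ
    set a0 := leafCount (fun x => φ x 0) Finset.univ
    set a1 := leafCount (fun x => φ x 1) Finset.univ
    set D0 := ∑ b, (fibreCard (fun x => φ x 0) Finset.univ b - 2)
    set D1 := ∑ b, (fibreCard (fun x => φ x 1) Finset.univ b - 2)
    have e : (1 / (m : ℝ)) ^ v0 * (t : ℝ) ^ (v0 - a0) * (1 / (t : ℝ)) ^ D0 *
        ((1 / (m : ℝ)) ^ v1 * (t : ℝ) ^ (v1 - a1) * (1 / (t : ℝ)) ^ D1) *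
          (M * (t : ℝ) ^ (3 * K + 4))
        = M / (m : ℝ) ^ (v0 + v1) * ((t : ℝ) ^ (v0 - a0 + (v1 - a1) + (3 * K + 4))
          / (t : ℝ) ^ (D0 + D1)) := by
      simp only [one_div, inv_pow, pow_add]
      field_simp
    rw [e]
    have e2 : (1 : ℝ) ≤ M / (m : ℝ) ^ (v0 + v1) := by
      rw [le_div_iff₀ (by positivity), one_mul]
      exact h4
    have e3 : (t : ℝ) ^ t ≤ (t : ℝ) ^ (v0 - a0 + (v1 - a1) + (3 * K + 4)) / (t : ℝ) ^ (D0 + D1) := by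
      rw [le_div_iff₀ (by positivity), ← pow_add]
      exact pow_le_pow_right₀ ht' (by omega)
    calc (t : ℝ) ^ t = 1 * (t : ℝ) ^ t := (one_mul _).symm
      _ ≤ _ := by gcongr
  have hcount : (P.ncard : ℝ) * (t : ℝ) ^ t
      ≤ (t.factorial * Real.exp (t / 2 + 2)) ^ 2 * (M * (t : ℝ) ^ (3 * K + 4)) := by
    calc (P.ncard : ℝ) * (t : ℝ) ^ t = ∑ φ ∈ P.toFinset, (t : ℝ) ^ t := by
          rw [Finset.sum_const, nsmul_eq_mul, Set.ncard_eq_toFinset_card']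
      _ ≤ ∑ φ ∈ P.toFinset, W φ * (M * (t : ℝ) ^ (3 * K + 4)) :=
          Finset.sum_le_sum fun φ hφ => hlow φ (by simpa using hφ)
      _ ≤ ∑ φ, W φ * (M * (t : ℝ) ^ (3 * K + 4)) :=
          Finset.sum_le_sum_of_subset_of_nonneg (Finset.subset_univ _) fun φ _ _ =>
            mul_nonneg (hW0 φ) (by positivity)
      _ = (∑ φ, W φ) * (M * (t : ℝ) ^ (3 * K + 4)) := by rw [Finset.sum_mul]
      _ ≤ _ := by gcongr
  have hexp : Real.exp (t / 2 + 2) ^ 2 = Real.exp 4 * Real.exp t := by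
    rw [← Real.exp_nat_mul, ← Real.exp_add]
    congr 1
    push_cast
    ring
  have h5 : Real.exp 5 = Real.exp 4 * Real.exp 1 := by
    rw [← Real.exp_add]; norm_num
  refine le_of_mul_le_mul_right (hcount.trans ?_) (by positivity : (0 : ℝ) < (t : ℝ) ^ t)
  rw [mul_pow, hexp, h5]
  calc (t.factorial : ℝ) ^ 2 * (Real.exp 4 * Real.exp t) * (M * (t : ℝ) ^ (3 * K + 4))
      = Real.exp 4 * M * (t : ℝ) ^ (3 * K + 4) * t.factorial * (t.factorial * Real.exp t) := by ring
    _ ≤ Real.exp 4 * M * (t : ℝ) ^ (3 * K + 4) * t.factorial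
          * (Real.exp 1 * t * (t : ℝ) ^ t) := by
        exact mul_le_mul_of_nonneg_left (factorial_mul_exp_le t ht) (by positivity)
    _ = _ := by ring

/-! ### Collisions under a hash function -/

open Finset in
/-- The number of keys of `T` that are lost to collisions under `g`. -/
def defect {U V : Type*} [DecidableEq V] (g : U → V) (T : Finset U) : ℕ :=
  #T - #(T.image g)

open Finset in
/-- At most `2 * defect g T` keys of `T` collide with another key of `T`. -/
theorem card_colliding_le {U V : Type*} [DecidableEq U] [DecidableEq V] (g : U → V)
    (T : Finset U) : #{x ∈ T | ∃ x' ∈ T, x' ≠ x ∧ g x' = g x} ≤ 2 * defect g T := by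
  set T₀ := {x ∈ T | ∃ x' ∈ T, x' ≠ x ∧ g x' = g x} with hT₀
  have h0 : #(T₀.image g) * 2 ≤ #T₀ := by
    rw [card_eq_sum_card_image g T₀, ← smul_eq_mul]
    refine card_nsmul_le_sum _ _ _ fun b hb => ?_
    obtain ⟨x, hx, rfl⟩ := mem_image.1 hb
    obtain ⟨hxT, x', hx', hne, he⟩ := mem_filter.1 hx
    refine one_lt_card.2 ⟨x, mem_filter.2 ⟨hx, rfl⟩, x', mem_filter.2 ⟨?_, he⟩, hne.symm⟩
    exact mem_filter.2 ⟨hx', x, hxT, hne.symm, he.symm⟩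
  have h1 : #(T.image g) ≤ #(T₀.image g) + #(T \ T₀) := by
    calc #(T.image g) ≤ #(T₀.image g ∪ (T \ T₀).image g) := by
          rw [← image_union, union_sdiff_of_subset (filter_subset _ _)]
      _ ≤ #(T₀.image g) + #((T \ T₀).image g) := card_union_le _ _
      _ ≤ _ := by gcongr; exact card_image_le
  have hsub : T₀ ⊆ T := filter_subset _ _
  have h2 := card_sdiff_add_card_eq_card hsub
  unfold defect
  omega

open Finset in
theorem defect_le_erase_add_one {U V : Type*} [DecidableEq U] [DecidableEq V] (g : U → V)
    (T : Finset U) (x : U) : defect g T ≤ defect g (T.erase x) + 1 := by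
  have h1 := card_le_card (image_subset_image (f := g) (erase_subset x T))
  have h2 := pred_card_le_card_erase (s := T) (a := x)
  unfold defect
  omega

open Finset in
/-- If `k` keys are lost to collisions, then there are `k` distinct keys `a i` that collide with
keys `b i` outside the set of the `a i`. -/
theorem exists_collisions {U V : Type*} [DecidableEq U] [DecidableEq V] (g : U → V)
    (T : Finset U) (k : ℕ) (hk : k ≤ defect g T) :
    ∃ a b : Fin k → T, Function.Injective a ∧ (∀ i j, a i ≠ b j) ∧ ∀ i, g (a i) = g (b i) := by
  have hinv : ∀ y ∈ T.image g, ∃ x : T, g x = y := by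
    intro y hy
    obtain ⟨x, hx, rfl⟩ := mem_image.1 hy
    exact ⟨⟨x, hx⟩, rfl⟩
  choose r hgr using hinv
  -- `R` contains one representative of each fibre
  let R : Finset T := (T.image g).attach.image fun y => r y.1 y.2
  have hR : #R ≤ #(T.image g) := card_image_le.trans_eq (card_attach)
  have hc : k ≤ #Rᶜ := by
    rw [card_compl, Fintype.card_coe]
    unfold defect at hk
    omega
  obtain ⟨E, hE, hEk⟩ := exists_subset_card_eq hc
  refine ⟨fun i => (E.equivFinOfCardEq hEk).symm i,
    fun i => r (g ((E.equivFinOfCardEq hEk).symm i)) (mem_image_of_mem g (Subtype.prop _)),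
    fun i j h => by simpa [Subtype.ext_iff] using h, fun i j h => ?_, fun i => (hgr _ _).symm⟩
  have h1 : (((E.equivFinOfCardEq hEk).symm i : E) : T) ∈ Rᶜ := hE (Subtype.prop _)
  refine mem_compl.1 h1 ?_
  rw [show (((E.equivFinOfCardEq hEk).symm i : E) : T) = _ from h]
  exact mem_image.2 ⟨⟨g ((E.equivFinOfCardEq hEk).symm j),
    mem_image_of_mem g (Subtype.prop _)⟩, mem_attach _ _, rfl⟩

open Finset in
theorem HashFamily.IsIndependent.unifProb_collisions_le {U : Type*} {l : ℕ}
    {H : HashFamily U (Fin l)} {k : ℕ} (hH : H.IsIndependent (2 * k)) {T : Finset U}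
    (a b : Fin k → T) (ha : Function.Injective a) (hab : ∀ i j, a i ≠ b j) :
    unifProb {σ : H.Seed | ∀ i, H.fn σ (a i) = H.fn σ (b i)} ≤ (1 / (l : ℝ)) ^ k := by
  classical
  let a' : Fin k → U := fun i => a i
  have ha' : Function.Injective a' := Subtype.val_injective.comp ha
  let b' : Fin k → U := fun i => b i
  let X : Finset U := univ.image a'
  let Y : Finset U := univ.image b'
  have hX : #X = k := by rw [card_image_of_injective _ ha', card_univ, Fintype.card_fin]
  have hXY : Disjoint X Y := by
    rw [disjoint_left]
    intro x hx hy
    obtain ⟨i, -, rfl⟩ := mem_image.1 hx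
    obtain ⟨j, -, h⟩ := mem_image.1 hy
    exact hab i j (Subtype.ext h.symm)
  have hcard : #(X ∪ Y) = k + #Y := by rw [card_union_of_disjoint hXY, hX]
  have hY : #Y ≤ k := card_image_le.trans_eq (by simp)
  rcases isEmpty_or_nonempty H.Seed with h | ⟨⟨σ₀⟩⟩
  · simp only [unifProb, Nat.card_of_isEmpty, Nat.cast_zero, div_zero]
    positivity
  have hb : ∀ i, b' i ∈ Y := fun i => mem_image_of_mem _ (mem_univ i)
  -- the values on `Y` determine those on `X`
  let v : (Y → Fin l) → U → Fin l := fun w x =>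
    if hx : x ∈ Y then w ⟨x, hx⟩
    else if hx : ∃ i, a' i = x then w ⟨b' hx.choose, hb _⟩ else H.fn σ₀ x
  have hcover : ∀ σ ∈ {σ : H.Seed | ∀ i, H.fn σ (a i) = H.fn σ (b i)},
      ∃ w ∈ (univ : Finset (Y → Fin l)), σ ∈ {σ : H.Seed | ∀ x ∈ X ∪ Y, H.fn σ x = v w x} := by
    intro σ hσ
    refine ⟨fun y => H.fn σ y, mem_univ _, fun x hx => ?_⟩
    by_cases hy : x ∈ Y
    · simp [v, hy]
    · have hx' : ∃ i, a' i = x := by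
        simpa [X] using (mem_union.1 hx).resolve_right hy
      simp only [v, hy, dif_pos hx', dite_false]
      conv_lhs => rw [← hx'.choose_spec]
      exact hσ hx'.choose
  refine (unifProb_le_sum _ _ hcover).trans ?_
  have hp : ∀ w : Y → Fin l, unifProb {σ : H.Seed | ∀ x ∈ X ∪ Y, H.fn σ x = v w x}
      = 1 / (l : ℝ) ^ (k + #Y) := by
    intro w
    rw [hH (X ∪ Y) (by omega) (v w), hcard, Nat.card_eq_fintype_card, Fintype.card_fin]
  rw [sum_congr rfl fun w _ => hp w, sum_const, card_univ, Fintype.card_fun, Fintype.card_fin,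
    Fintype.card_coe, nsmul_eq_mul, one_div_pow, pow_add]
  rcases Nat.eq_zero_or_pos l with rfl | hl
  · rcases Nat.eq_zero_or_pos k with rfl | hk
    · have : #Y = 0 := by omega
      simp [this]
    · simp [hk.ne']
  · have : (0 : ℝ) < l := by exact_mod_cast hl
    push_cast
    apply le_of_eq
    field_simp

open Finset in
/-- A `2k`-wise independent function into `[l]` loses `k` keys of `T` to collisions with probability
at most `(|T|² / l)^k`. -/
theorem HashFamily.IsIndependent.unifProb_le_defect_le {U : Type*} {l : ℕ}
    {H : HashFamily U (Fin l)} {k : ℕ} (hH : H.IsIndependent (2 * k)) (T : Finset U) :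
    unifProb {σ : H.Seed | k ≤ defect (H.fn σ) T} ≤ ((#T : ℝ) ^ 2 / l) ^ k := by
  classical
  refine (unifProb_le_sum ({p : (Fin k → T) × (Fin k → T) |
      Function.Injective p.1 ∧ ∀ i j, p.1 i ≠ p.2 j} : Finset _)
    (fun p => {σ : H.Seed | ∀ i, H.fn σ (p.1 i) = H.fn σ (p.2 i)}) ?_).trans ?_
  · intro σ hσ
    obtain ⟨a, b, h1, h2, h3⟩ := exists_collisions (H.fn σ) T k hσ
    exact ⟨(a, b), by simp [h1]; simpa using h2, h3⟩
  · refine (sum_le_card_nsmul _ _ ((1 / (l : ℝ)) ^ k) fun p hp => ?_).trans ?_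
    · obtain ⟨h1, h2⟩ := (mem_filter.1 hp).2
      exact hH.unifProb_collisions_le p.1 p.2 h1 h2
    · rw [nsmul_eq_mul]
      have h : #({p : (Fin k → T) × (Fin k → T) |
          Function.Injective p.1 ∧ ∀ i j, p.1 i ≠ p.2 j} : Finset _) ≤ (#T ^ 2) ^ k := by
        refine (card_le_univ _).trans_eq ?_
        rw [Fintype.card_prod, Fintype.card_fun, Fintype.card_coe, Fintype.card_fin]
        ring
      calc _ ≤ (((#T ^ 2) ^ k : ℕ) : ℝ) * (1 / (l : ℝ)) ^ k := by gcongr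
        _ = _ := by push_cast; rw [← mul_pow, mul_one_div]

/-! ### Hash functions combined with random tables -/

open Finset in
/-- If some `g j` has few collisions on `T`, then `x ↦ H(x) + ∑ j, y j [g j x]` is uniform on `T`:
the table `y j` provides independent values for the keys that do not collide under `g j`, and the
at most `2k` other keys are covered by the independence of `H`. -/
theorem uniformOn_of_defect_le {U A : Type*} [AddCommGroup A] [Finite A] {l c k : ℕ}
    {H : HashFamily U A} (hH : H.IsIndependent (2 * k)) (g : Fin c → U → Fin l) (T : Finset U)
    (j : Fin c) (hj : defect (g j) T ≤ k) :
    UniformOn (fun (ω : (Fin c → Fin l → A) × H.Seed) x =>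
      H.fn ω.2 x + ∑ j, ω.1 j (g j x)) T := by
  classical
  set T₀ := {x ∈ T | ∃ x' ∈ T, x' ≠ x ∧ g j x' = g j x} with hT₀
  have key : ∀ X ⊆ T \ T₀, UniformOn (fun (ω : (Fin c → Fin l → A) × H.Seed) x =>
      H.fn ω.2 x + ∑ j, ω.1 j (g j x)) (T₀ ∪ X) := by
    intro X
    induction X using Finset.induction_on with
    | empty =>
      intro _ v
      rw [union_empty]
      refine unifProb_prod_const fun y => ?_
      rw [← hH T₀ ((card_colliding_le (g j) T).trans (by omega)) fun x => v x - ∑ j, y j (g j x)]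
      congr 1
      ext σ
      simp [eq_sub_iff_add_eq]
    | insert x X hx ih =>
      intro hX
      have hxT := mem_sdiff.1 (hX (mem_insert_self x X))
      rw [union_insert]
      have hne : ∀ x' ∈ T, x' ≠ x → g j x' ≠ g j x := fun x' h1 h2 h3 =>
        hxT.2 (mem_filter.2 ⟨hxT.1, x', h1, h2, h3⟩)
      have hnot : x ∉ T₀ ∪ X := by
        rw [mem_union]; exact fun h => h.elim hxT.2 hx
      -- shift the entry `g j x` of the table `y j`
      refine (ih ((subset_insert x X).trans hX)).insert_of_shift hnot
        (fun a ω => (ω.1 + Pi.single j (Pi.single (g j x) a), ω.2)) ?_ ?_ ?_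
      · rintro a ⟨y, σ⟩ ⟨y', σ'⟩ h
        simpa using h
      · rintro a ⟨y, σ⟩
        simp only [Pi.add_apply, sum_add_distrib, ← add_assoc]
        congr 1
        rw [sum_eq_single j (by intro i _ hi; simp [hi]) (by simp)]
        simp
      · rintro a ⟨y, σ⟩ x' hx'
        have h1 : x' ∈ T := (mem_union.1 hx').elim (fun h => (mem_filter.1 h).1)
          fun h => (mem_sdiff.1 (hX (mem_insert_of_mem h))).1
        have h2 := hne x' h1 (fun h => hnot (h ▸ hx'))
        simp only [Pi.add_apply, sum_add_distrib]
        congr 1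
        rw [add_eq_left]
        refine sum_eq_zero fun i _ => ?_
        rcases eq_or_ne i j with rfl | hi
        · simp [h2]
        · simp [hi]
  have h := key (T \ T₀) Subset.rfl
  rwa [union_sdiff_of_subset (filter_subset _ _)] at h

/-! ### Uniformity of the hash function for a fixed pair of hash functions -/

open Finset in
theorem exists_unique_edge_of_fibreCard_eq_one {U V : Type*} [DecidableEq V] {h : U → V}
    {T : Finset U} {b : V} (hb : fibreCard h T b = 1) :
    ∃ x ∈ T, h x = b ∧ ∀ x' ∈ T, h x' = b → x' = x := by
  obtain ⟨x, hx⟩ := card_eq_one.1 hb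
  have h1 : ∀ x', x' ∈ T ∧ h x' = b ↔ x' = x := fun x' => by
    simpa using Finset.ext_iff.1 hx x'
  exact ⟨x, ((h1 x).2 rfl).1, ((h1 x).2 rfl).2, fun x' h2 h3 => (h1 x').1 ⟨h2, h3⟩⟩

/-- The pair `p` is bad for `S` if the graph of `p` on `S` has a leafless subgraph whose edges
have more than `k` collisions under each of the functions `g j`. -/
def PairSeed.IsBad {U : Type*} {m l c : ℕ} {Hm : HashFamily U (Fin m)} {Hl : HashFamily U (Fin l)}
    (p : PairSeed Hm Hl c) (k : ℕ) (S : Finset U) : Prop :=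
  ∃ T ⊆ S, ∑ i, leafCount (p.hash i) T = 0 ∧ ∀ j, k < defect (Hl.fn (p.g j)) T

open Finset in
/-- If the pair of hash functions is not bad, the keys that do not lie in the 2-core of the graph
are peeled off at leaves, where each of them has a table entry of its own. -/
theorem PairSeed.uniformOn_of_not_isBad {U R : Type*} [AddCommGroup R] [Finite R] {m l c k : ℕ}
    {Hm : HashFamily U (Fin m)} {Hl : HashFamily U (Fin l)} {HR : HashFamily U R}
    (hR : HR.IsIndependent (2 * k)) (p : PairSeed Hm Hl c) (S : Finset U) (hp : ¬p.IsBad k S) :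
    UniformOn (fun (ω : (Fin 2 → Fin m → R) × ((Fin c → Fin l → R) × HR.Seed)) x =>
      (HR.fn ω.2.2 x + ∑ j, ω.2.1 j (Hl.fn (p.g j) x)) + ∑ i, ω.1 i (p.hash i x)) S := by
  classical
  induction S using Finset.strongInduction with
  | H S ih =>
  by_cases hS : ∑ i, leafCount (p.hash i) S = 0
  · have hgood : ∃ j, defect (Hl.fn (p.g j)) S ≤ k := by
      by_contra! h
      exact hp ⟨S, Subset.rfl, hS, h⟩
    obtain ⟨j, hj⟩ := hgood
    intro v
    refine unifProb_prod_const fun t => ?_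
    rw [← uniformOn_of_defect_le hR (fun j => Hl.fn (p.g j)) S j hj
      fun x => v x - ∑ i, t i (p.hash i x)]
    congr 1
    ext ω
    simp only [Set.mem_ofPred_eq, eq_sub_iff_add_eq]
  · obtain ⟨i, -, hi⟩ := exists_ne_zero_of_sum_ne_zero hS
    obtain ⟨b, hb⟩ := card_pos.1 (Nat.pos_of_ne_zero hi)
    obtain ⟨x, hx, rfl, hux⟩ := exists_unique_edge_of_fibreCard_eq_one (mem_filter.1 hb).2
    have hp' : ¬p.IsBad k (S.erase x) := fun ⟨T, hT, h⟩ => hp ⟨T, hT.trans (erase_subset _ _), h⟩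
    rw [← insert_erase hx]
    refine (ih (S.erase x) (erase_ssubset hx) hp').insert_of_shift (notMem_erase x S)
      (fun a ω => (ω.1 + Pi.single i (Pi.single (p.hash i x) a), ω.2)) ?_ ?_ ?_
    · rintro a ⟨y, σ⟩ ⟨y', σ'⟩ h
      simpa using h
    · rintro a ⟨t, ω⟩
      simp only [Pi.add_apply, sum_add_distrib, ← add_assoc]
      congr 1
      rw [sum_eq_single i (by intro i' _ hi; simp [hi]) (by simp)]
      simp
    · rintro a ⟨t, ω⟩ x' hx'
      obtain ⟨h1, h2⟩ := mem_erase.1 hx'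
      have h3 : p.hash i x' ≠ p.hash i x := fun h => h1 (hux x' h2 h)
      simp only [Pi.add_apply, sum_add_distrib]
      congr 1
      rw [add_eq_left]
      refine sum_eq_zero fun i' _ => ?_
      rcases eq_or_ne i' i with rfl | hi
      · simp [h3]
      · simp [hi]

/-- The pair and the remaining components of the data structure. -/
def DSSeed.equivProd {U R : Type*} {m l c : ℕ} (Hm : HashFamily U (Fin m))
    (Hl : HashFamily U (Fin l)) (HR : HashFamily U R) :
    DSSeed Hm Hl HR c ≃
      PairSeed Hm Hl c × ((Fin 2 → Fin m → R) × ((Fin c → Fin l → R) × HR.Seed)) where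
  toFun ω := (ω.pair, ω.t, ω.y, ω.f)
  invFun q := ⟨q.1, q.2.1, q.2.2.1, q.2.2.2⟩
  left_inv _ := rfl
  right_inv _ := rfl

theorem DSSeed.unifProb_not_isBad_inter {U R : Type*} [AddCommGroup R] [Finite R] {m l c k : ℕ}
    {Hm : HashFamily U (Fin m)} {Hl : HashFamily U (Fin l)} {HR : HashFamily U R}
    (hR : HR.IsIndependent (2 * k)) (S : Finset U) (v : U → R) :
    unifProb ({ω : DSSeed Hm Hl HR c | ω.pair.IsBad k S}ᶜ ∩ {ω | ∀ x ∈ S, ω.hash x = v x})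
      = unifProb {ω : DSSeed Hm Hl HR c | ω.pair.IsBad k S}ᶜ
        * (1 / (Nat.card R : ℝ) ^ S.card) := by
  let e := DSSeed.equivProd (c := c) Hm Hl HR
  have h1 : {ω : DSSeed Hm Hl HR c | ω.pair.IsBad k S}ᶜ
      = e ⁻¹' {q | q.1 ∈ {p : PairSeed Hm Hl c | p.IsBad k S}ᶜ} := rfl
  have h2 : {ω : DSSeed Hm Hl HR c | ω.pair.IsBad k S}ᶜ ∩ {ω | ∀ x ∈ S, ω.hash x = v x}
      = e ⁻¹' {q | q.1 ∈ {p : PairSeed Hm Hl c | p.IsBad k S}ᶜ ∧ ∀ x ∈ S,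
        (HR.fn q.2.2.2 x + ∑ j, q.2.2.1 j (Hl.fn (q.1.g j) x)) + ∑ i, q.2.1 i (q.1.hash i x)
          = v x} := by
    ext ω
    refine and_congr Iff.rfl (forall₂_congr fun x _ => ?_)
    refine Eq.congr_left ?_
    simp only [DSSeed.hash, Fin.sum_univ_two, e, DSSeed.equivProd, Equiv.coe_fn_mk]
    abel
  rw [h2, h1, unifProb_preimage_equiv, unifProb_preimage_equiv, unifProb_fst]
  refine unifProb_prod_eq (fun p hp => ?_) fun p hp q hq => hp hq.1
  rw [← p.uniformOn_of_not_isBad hR S hp v]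
  congr 1
  ext ω
  exact and_iff_right hp

/-! ### Peeling a leafless graph -/

open Finset in
theorem fibreCard_erase {U V : Type*} [DecidableEq U] [DecidableEq V] (h : U → V) {T : Finset U}
    {x : U} (hx : x ∈ T) (b : V) :
    fibreCard h (T.erase x) b + (if b = h x then 1 else 0) = fibreCard h T b := by
  unfold fibreCard
  rw [filter_erase]
  split_ifs with hb
  · exact card_erase_add_one (mem_filter.2 ⟨hx, hb.symm⟩)
  · rw [add_zero, erase_eq_of_notMem fun hm => hb (mem_filter.1 hm).2.symm]

open Finset in
theorem vertexCount_erase_le {U V : Type*} [DecidableEq U] [Fintype V] [DecidableEq V] (h : U → V)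
    {T : Finset U} {x : U} (hx : x ∈ T) : vertexCount h (T.erase x) ≤ vertexCount h T := by
  refine card_le_card fun b hb => ?_
  have h1 := fibreCard_erase h hx b
  have h2 := (mem_filter.1 hb).2
  exact mem_filter.2 ⟨mem_univ b, by omega⟩

open Finset in
theorem leafCount_erase_le {U V : Type*} [DecidableEq U] [Fintype V] [DecidableEq V] (h : U → V)
    {T : Finset U} {x : U} (hx : x ∈ T) : leafCount h (T.erase x) ≤ leafCount h T + 1 := by
  refine (card_le_card fun b hb => ?_).trans (card_insert_le (h x) _)
  have h1 := fibreCard_erase h hx b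
  have h2 := (mem_filter.1 hb).2
  rw [mem_insert, mem_filter]
  split_ifs at h1 with h3
  · exact Or.inl h3
  · exact Or.inr ⟨mem_univ b, by omega⟩

open Finset in
theorem leafCount_erase_lt {U V : Type*} [DecidableEq U] [Fintype V] [DecidableEq V] (h : U → V)
    {T : Finset U} {x : U} (hx : x ∈ T) (hleaf : fibreCard h T (h x) = 1) :
    leafCount h (T.erase x) < leafCount h T := by
  refine card_lt_card (ssubset_of_subset_of_ne (fun b hb => ?_) fun he => ?_)
  · have h1 := fibreCard_erase h hx b
    have h2 := (mem_filter.1 hb).2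
    refine mem_filter.2 ⟨mem_univ b, ?_⟩
    split_ifs at h1 with h3
    · subst h3; omega
    · omega
  · have h1 : h x ∈ ({b | fibreCard h (T.erase x) b = 1} : Finset V) := by
      rw [he]
      exact mem_filter.2 ⟨mem_univ _, hleaf⟩
    have h2 := fibreCard_erase h hx (h x)
    have h3 := (mem_filter.1 h1).2
    rw [if_pos rfl] at h2
    omega

open Finset in
/-- Every nonempty graph with at most two leaves has an edge whose removal leaves a graph with at
most two leaves: an edge at a leaf, or any edge if there are no leaves. -/
theorem exists_erase_leafCount_le_two {U V : Type*} [DecidableEq U] [Fintype V] [DecidableEq V]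
    (h : Fin 2 → U → V) {T : Finset U} (hT : T.Nonempty) (hleaf : ∑ i, leafCount (h i) T ≤ 2) :
    ∃ x ∈ T, ∑ i, leafCount (h i) (T.erase x) ≤ 2 := by
  by_cases hex : ∃ i b, fibreCard (h i) T b = 1
  · obtain ⟨i, b, hb⟩ := hex
    obtain ⟨x, hx, rfl, -⟩ := exists_unique_edge_of_fibreCard_eq_one hb
    refine ⟨x, hx, ?_⟩
    have h1 := leafCount_erase_lt (h i) hx hb
    have h2 := leafCount_erase_le (h 0) hx
    have h3 := leafCount_erase_le (h 1) hx
    rw [Fin.sum_univ_two] at hleaf ⊢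
    have : i = 0 ∨ i = 1 := by omega
    rcases this with rfl | rfl <;> omega
  · push Not at hex
    obtain ⟨x, hx⟩ := hT
    refine ⟨x, hx, ?_⟩
    have h0 : ∀ i, leafCount (h i) T = 0 := fun i => by
      rw [leafCount, card_eq_zero, filter_eq_empty_iff]
      exact fun b _ => hex i b
    have h2 := leafCount_erase_le (h 0) hx
    have h3 := leafCount_erase_le (h 1) hx
    rw [Fin.sum_univ_two]
    have := h0 0
    have := h0 1
    omega

open Finset in
/-- Removing an edge lowers each `defect (g j)` by at most one, and also the excess of the number of
edges over the number of vertices. Hence, when edges are peeled off one by one from a graph with at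
most two leaves in which all defects are at least `k` or the excess is at least `K`, there is a
first moment at which some defect is at most `k` and the excess is at most `K`; one of the two lower
bounds still holds then. -/
theorem exists_critical_subgraph {U V W ι : Type*} [DecidableEq U] [Fintype V] [DecidableEq V]
    [DecidableEq W] [Nonempty ι] (h : Fin 2 → U → V) (g : ι → U → W) (k K : ℕ) (S : Finset U)
    (hleaf : ∑ i, leafCount (h i) S ≤ 2)
    (hS : (∀ j, k ≤ defect (g j) S) ∨ ∑ i, vertexCount (h i) S + K ≤ #S) :
    ∃ T ⊆ S, ∑ i, leafCount (h i) T ≤ 2 ∧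
      ((∀ j, k ≤ defect (g j) T) ∨ ∑ i, vertexCount (h i) T + K ≤ #T) ∧
      (∃ j, defect (g j) T ≤ k) ∧ #T ≤ ∑ i, vertexCount (h i) T + K := by
  induction S using Finset.strongInduction with
  | H S ih =>
  by_cases hdone : (∃ j, defect (g j) S ≤ k) ∧ #S ≤ ∑ i, vertexCount (h i) S + K
  · exact ⟨S, Subset.rfl, hleaf, hS, hdone⟩
  have hne : S.Nonempty := by
    rw [nonempty_iff_ne_empty]
    rintro rfl
    exact hdone ⟨⟨Classical.arbitrary ι, by simp [defect]⟩, by simp⟩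
  obtain ⟨x, hx, hxl⟩ := exists_erase_leafCount_le_two h hne hleaf
  obtain ⟨T, hT, h1⟩ := ih (S.erase x) (erase_ssubset hx) hxl (by
    rcases not_and_or.1 hdone with hd | hd
    · left
      intro j
      push Not at hd
      have := defect_le_erase_add_one (g j) S x
      have := hd j
      omega
    · right
      have h2 := vertexCount_erase_le (h 0) hx
      have h3 := vertexCount_erase_le (h 1) hx
      have h4 := card_erase_add_one hx
      rw [Fin.sum_univ_two] at hd ⊢
      omega)
  exact ⟨T, hT.trans (erase_subset _ _), h1⟩

/-! ### The probability of a bad pair -/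

/-- A pair of independent members of the family `H`. -/
def HashFamily.sq {U V : Type*} (H : HashFamily U V) : HashFamily U (Fin 2 → V) where
  Seed := Fin 2 → H.Seed
  finite := inferInstance
  nonempty := inferInstance
  fn σ x i := H.fn (σ i) x

theorem HashFamily.IsIndependent.sq {U V : Type*} {H : HashFamily U V} {κ : ℕ}
    (hH : H.IsIndependent κ) : H.sq.IsIndependent κ := by
  intro T hT v
  have h1 : {σ : H.sq.Seed | ∀ x ∈ T, H.sq.fn σ x = v x}
      = {σ : Fin 2 → H.Seed | ∀ i, σ i ∈ {σ | ∀ x ∈ T, H.fn σ x = v x i}} := by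
    ext σ
    simp only [Set.mem_ofPred_eq, HashFamily.sq, funext_iff]
    exact ⟨fun h i x hx => h x hx i, fun h x hx i => h i x hx⟩
  rw [h1]
  refine (unifProb_pi (ι := Fin 2) (α := H.Seed) _).trans ?_
  rw [Fin.prod_univ_two, hH T hT, hH T hT]
  simp only [Nat.card_pi, Fin.prod_univ_two, Nat.cast_mul, mul_pow]
  field_simp

/-- The functions `g j`, and the remaining components of a pair, arranged as one table and one hash
function with values in `[m] × [m]`. -/
def PairSeed.equivProd {U : Type*} {m l c : ℕ} (Hm : HashFamily U (Fin m))
    (Hl : HashFamily U (Fin l)) :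
    PairSeed Hm Hl c ≃
      (Fin c → Hl.Seed) × ((Fin c → Fin l → Fin 2 → Fin m) × Hm.sq.Seed) where
  toFun p := (p.g, fun j b i => p.z i j b, p.f)
  invFun q := ⟨q.2.2, q.1, fun i j b => q.2.1 j b i⟩
  left_inv _ := rfl
  right_inv _ := rfl

theorem Fin.val_sum_eq_mod {ι : Type*} {m : ℕ} [NeZero m] (s : Finset ι) (a : ι → Fin m) :
    (∑ j ∈ s, a j).val = (∑ j ∈ s, (a j).val) % m := by
  classical
  induction s using Finset.induction_on with
  | empty => simp
  | insert j s hj ih =>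
    rw [Finset.sum_insert hj, Finset.sum_insert hj, Fin.val_add, ih, Nat.add_mod_mod]

theorem PairSeed.hash_eq {U : Type*} {m l c : ℕ} [NeZero m] {Hm : HashFamily U (Fin m)}
    {Hl : HashFamily U (Fin l)} (p : PairSeed Hm Hl c) (i : Fin 2) (x : U) :
    p.hash i x = Hm.fn (p.f i) x + ∑ j, p.z i j (Hl.fn (p.g j) x) := by
  apply Fin.ext
  rw [Fin.val_add, Fin.val_sum_eq_mod, Nat.add_mod_mod]
  rfl

open Finset in
theorem fibreCard_restrict {U V : Type*} [DecidableEq V] (h : U → V) (T : Finset U) (b : V) :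
    fibreCard (fun x : T => h x) univ b = fibreCard h T b := by
  unfold fibreCard
  rw [card_filter, card_filter]
  exact sum_coe_sort T fun x => if h x = b then 1 else 0

/-- Given functions `g j`, one of which has few collisions on `T`, the graph of the pair on `T` is a
uniformly random graph. -/
theorem PairSeed.unifProb_graph_le {U : Type*} {m l c k : ℕ} (hm : 1 ≤ m)
    {Hm : HashFamily U (Fin m)} {Hl : HashFamily U (Fin l)} (hHm : Hm.IsIndependent (2 * k))
    (T : Finset U) (hT : T.Nonempty) (K : ℕ) (M : ℝ) (hM0 : 0 < M) (G : Set (Fin c → Hl.Seed))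
    (E : Set (PairSeed Hm Hl c))
    (hE : ∀ p ∈ E, p.g ∈ G ∧ (∃ j, defect (Hl.fn (p.g j)) T ≤ k) ∧
      ∑ i, leafCount (p.hash i) T ≤ 2 ∧ T.card ≤ ∑ i, vertexCount (p.hash i) T + K ∧
      (m : ℝ) ^ ∑ i, vertexCount (p.hash i) T ≤ M) :
    unifProb E ≤ unifProb G *
      (Real.exp 5 * M * (T.card : ℝ) ^ (3 * K + 5) * T.card.factorial / ((m : ℝ) ^ 2) ^ T.card) := by
  classical
  have : NeZero m := ⟨by omega⟩
  let P : Set (T → Fin 2 → Fin m) := {φ | ∑ i, leafCount (fun x => φ x i) Finset.univ ≤ 2 ∧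
    T.card ≤ ∑ i, vertexCount (fun x => φ x i) Finset.univ + K ∧
    (m : ℝ) ^ ∑ i, vertexCount (fun x => φ x i) Finset.univ ≤ M}
  have hP := card_graphs_le m T.card K hm hT.card_pos (Fintype.card_coe T) M hM0 P
    (fun φ hφ => hφ.1) (fun φ hφ => hφ.2.1) (fun φ hφ => hφ.2.2)
  let F : (Fin c → Hl.Seed) → (Fin c → Fin l → Fin 2 → Fin m) × Hm.sq.Seed → U → Fin 2 → Fin m :=
    fun g ω x => Hm.sq.fn ω.2 x + ∑ j, ω.1 j (Hl.fn (g j) x)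
  have hF : ∀ p : PairSeed Hm Hl c, ∀ i x,
      F p.g (PairSeed.equivProd Hm Hl p).2 x i = p.hash i x := by
    intro p i x
    rw [p.hash_eq]
    simp only [F, Pi.add_apply, Finset.sum_apply]
    rfl
  let E' : Set ((Fin c → Hl.Seed) × ((Fin c → Fin l → Fin 2 → Fin m) × Hm.sq.Seed)) :=
    {q | (q.1 ∈ G ∧ ∃ j, defect (Hl.fn (q.1 j)) T ≤ k) ∧ (fun x : T => F q.1 q.2 x) ∈ P}
  have hsub : E ⊆ PairSeed.equivProd Hm Hl ⁻¹' E' := by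
    intro p hp
    obtain ⟨h1, h2, h3, h4, h5⟩ := hE p hp
    have hl : ∀ i, leafCount (fun x : T => F p.g (PairSeed.equivProd Hm Hl p).2 x i) Finset.univ
        = leafCount (p.hash i) T := fun i => by
      simp only [leafCount, hF, fibreCard_restrict]
    have hv : ∀ i, vertexCount (fun x : T => F p.g (PairSeed.equivProd Hm Hl p).2 x i) Finset.univ
        = vertexCount (p.hash i) T := fun i => by
      simp only [vertexCount, hF, fibreCard_restrict]
    refine ⟨⟨h1, h2⟩, ?_, ?_, ?_⟩
    · exact (Finset.sum_congr rfl fun i _ => hl i).trans_le h3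
    · exact h4.trans_eq (congrArg (· + K) (Finset.sum_congr rfl fun i _ => (hv i).symm))
    · exact (congrArg ((m : ℝ) ^ ·) (Finset.sum_congr rfl fun i _ => hv i)).trans_le h5
  refine (unifProb_mono hsub).trans ?_
  rw [unifProb_preimage_equiv]
  refine unifProb_prod_le (fun g hg => ?_) (fun g hg ω h => hg h.1.1)
  by_cases hgood : ∃ j, defect (Hl.fn (g j)) T ≤ k
  · obtain ⟨j, hj⟩ := hgood
    have hu := uniformOn_of_defect_le hHm.sq (fun j => Hl.fn (g j)) T j hj
    refine (unifProb_mono fun ω hω => ?_).trans ((hu.unifProb_restrict P).trans ?_)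
    · exact hω.2
    · rw [show (Nat.card (Fin 2 → Fin m) : ℝ) = (m : ℝ) ^ 2 by simp]
      gcongr
  · rw [show {b | (g, b) ∈ E'} = ∅ from Set.eq_empty_of_forall_notMem fun ω h => hgood h.1.2]
    simp only [unifProb, Set.ncard_empty, Nat.cast_zero, zero_div]
    positivity

/-- Summation over the subsets of a set of `n` keys, where a fixed set of `t` keys contributes
`q * t ^ a * t! / m ^ t`. -/
theorem sum_powerset_le {U : Type*} (S : Finset U) (m a : ℕ) (hm : 1 ≤ m) (r q : ℝ) (hr0 : 0 ≤ r)
    (hr1 : r < 1) (hr : (S.card : ℝ) ≤ r * m) (hq : 0 ≤ q) :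
    ∑ T ∈ S.powerset, q * (T.card : ℝ) ^ a * T.card.factorial / (m : ℝ) ^ T.card
      ≤ q * ∑' t : ℕ, (t : ℝ) ^ a * r ^ t := by
  have hm' : (0 : ℝ) < m := by exact_mod_cast hm
  have hs : Summable fun t : ℕ => (t : ℝ) ^ a * r ^ t :=
    summable_pow_mul_geometric_of_norm_lt_one a (by rwa [Real.norm_of_nonneg hr0])
  rw [Finset.sum_powerset_apply_card (fun t : ℕ => q * (t : ℝ) ^ a * t.factorial / (m : ℝ) ^ t)]
  calc _ ≤ ∑ t ∈ Finset.range (S.card + 1), q * ((t : ℝ) ^ a * r ^ t) := by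
        refine Finset.sum_le_sum fun t _ => ?_
        have h1 : (S.card.choose t : ℝ) * t.factorial ≤ (S.card : ℝ) ^ t := by
          have h2 := Nat.descFactorial_le_pow S.card t
          rw [Nat.descFactorial_eq_factorial_mul_choose, mul_comm] at h2
          exact_mod_cast h2
        have h2 : (S.card.choose t : ℝ) * t.factorial / (m : ℝ) ^ t ≤ r ^ t := by
          rw [div_le_iff₀ (by positivity), ← mul_pow]
          exact h1.trans (pow_le_pow_left₀ (by positivity) hr t)
        calc S.card.choose t • (q * (t : ℝ) ^ a * t.factorial / (m : ℝ) ^ t)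
            = q * ((t : ℝ) ^ a * ((S.card.choose t : ℝ) * t.factorial / (m : ℝ) ^ t)) := by
              rw [nsmul_eq_mul]; ring
          _ ≤ _ := by gcongr
    _ = q * ∑ t ∈ Finset.range (S.card + 1), (t : ℝ) ^ a * r ^ t := by rw [Finset.mul_sum]
    _ ≤ _ := by
        gcongr
        exact hs.sum_le_tsum _ fun t _ => by positivity

/-- A union bound over the critical subgraphs `T` of a leafless graph with many collisions. The event
`EA T` is that all `g j` have at least `k` collisions on `T`, and `EB T` that `T` has `K` more edges
than vertices. -/
theorem PairSeed.unifProb_isBad_le {U : Type*} {m l c k : ℕ} (hk : 1 ≤ k) (hc : 1 ≤ c) (hm : 1 ≤ m)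
    {Hm : HashFamily U (Fin m)} {Hl : HashFamily U (Fin l)} (hHm : Hm.IsIndependent (2 * k))
    (hHl : Hl.IsIndependent (2 * k)) (S : Finset U) (r : ℝ) (hr0 : 0 ≤ r) (hr1 : r < 1)
    (hr : (S.card : ℝ) ≤ r * m) (K : ℕ) (hK : 1 ≤ K) :
    unifProb {p : PairSeed Hm Hl c | p.IsBad k S} ≤
      Real.exp 5 * (m / (l : ℝ) ^ (k * c) + 1 / (m : ℝ) ^ K)
        * ∑' t : ℕ, (t : ℝ) ^ (3 * K + 5 + 2 * (k * c)) * r ^ t := by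
  classical
  have hm' : (0 : ℝ) < m := by exact_mod_cast hm
  have : Nonempty (Fin c) := ⟨⟨0, hc⟩⟩
  let GA : Finset U → Set (Fin c → Hl.Seed) := fun T => {g | ∀ j, g j ∈ {σ | k ≤ defect (Hl.fn σ) T}}
  let EA : Finset U → Set (PairSeed Hm Hl c) := fun T => {p | p.g ∈ GA T ∧
    (∃ j, defect (Hl.fn (p.g j)) T ≤ k) ∧ ∑ i, leafCount (p.hash i) T ≤ 2 ∧
    T.card ≤ ∑ i, vertexCount (p.hash i) T + K}
  let EB : Finset U → Set (PairSeed Hm Hl c) := fun T => {p |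
    (∃ j, defect (Hl.fn (p.g j)) T ≤ k) ∧ ∑ i, leafCount (p.hash i) T ≤ 2 ∧
    T.card ≤ ∑ i, vertexCount (p.hash i) T + K ∧ ∑ i, vertexCount (p.hash i) T + K ≤ T.card}
  have hA : ∀ T : Finset U, T.Nonempty → unifProb (EA T) ≤ Real.exp 5 * (m / (l : ℝ) ^ (k * c))
      * (T.card : ℝ) ^ (3 * K + 5 + 2 * (k * c)) * T.card.factorial / (m : ℝ) ^ T.card := by
    intro T hT
    have h1 := PairSeed.unifProb_graph_le hm hHm T hT K ((m : ℝ) ^ (T.card + 1)) (by positivity)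
      (GA T) (EA T) (by
        rintro p ⟨h1, h2, h3, h4⟩
        refine ⟨h1, h2, h3, h4, pow_le_pow_right₀ (by exact_mod_cast hm) ?_⟩
        -- the sum of the degrees is twice the number of edges, and at most two degrees are one
        have e0 := two_mul_vertexCount_add (p.hash 0) T
        have e1 := two_mul_vertexCount_add (p.hash 1) T
        rw [Fin.sum_univ_two] at h3 ⊢
        omega)
    have h2 : unifProb (GA T) ≤ (((T.card : ℝ) ^ 2 / l) ^ k) ^ c := by
      refine (unifProb_pi _).trans_le ?_
      refine (Finset.prod_le_prod (fun _ _ => unifProb_nonneg _)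
        fun _ _ => hHl.unifProb_le_defect_le T).trans_eq ?_
      rw [Finset.prod_const, Finset.card_univ, Fintype.card_fin]
    refine h1.trans ((mul_le_mul_of_nonneg_right h2 (by positivity)).trans_eq ?_)
    rw [← pow_mul, div_pow, ← pow_mul, pow_add _ (3 * K + 5), pow_succ (m : ℝ), ← pow_mul,
      two_mul T.card, pow_add (m : ℝ) T.card]
    field_simp
  have hB : ∀ T : Finset U, T.Nonempty → unifProb (EB T) ≤ Real.exp 5 * (1 / (m : ℝ) ^ K)
      * (T.card : ℝ) ^ (3 * K + 5 + 2 * (k * c)) * T.card.factorial / (m : ℝ) ^ T.card := by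
    intro T hT
    have h1 := PairSeed.unifProb_graph_le hm hHm T hT K ((m : ℝ) ^ T.card / (m : ℝ) ^ K)
      (by positivity) Set.univ (EB T) (by
        rintro p ⟨h2, h3, h4, h5⟩
        refine ⟨Set.mem_univ _, h2, h3, h4, ?_⟩
        rw [le_div_iff₀ (by positivity), ← pow_add]
        exact pow_le_pow_right₀ (by exact_mod_cast hm) h5)
    rw [unifProb_univ, one_mul] at h1
    have h2 : (T.card : ℝ) ^ (3 * K + 5) ≤ (T.card : ℝ) ^ (3 * K + 5 + 2 * (k * c)) :=
      pow_le_pow_right₀ (by exact_mod_cast hT.card_pos) (by omega)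
    refine h1.trans ?_
    calc _ = Real.exp 5 * (1 / (m : ℝ) ^ K)
          * (T.card : ℝ) ^ (3 * K + 5) * T.card.factorial / (m : ℝ) ^ T.card := by
          rw [← pow_mul, two_mul T.card, pow_add (m : ℝ) T.card]
          field_simp
      _ ≤ _ := by gcongr
  have hcover : ∀ p ∈ {p : PairSeed Hm Hl c | p.IsBad k S},
      ∃ T ∈ S.powerset.filter Finset.Nonempty, p ∈ EA T ∪ EB T := by
    rintro p ⟨T₀, hT₀, h0, hd⟩
    obtain ⟨T, hT, h1, h2, ⟨j, hj⟩, h4⟩ := exists_critical_subgraph p.hash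
      (fun j => Hl.fn (p.g j)) k K T₀ (by omega) (Or.inl fun j => (hd j).le)
    have hne : T.Nonempty := by
      rw [Finset.nonempty_iff_ne_empty]
      rintro rfl
      rcases h2 with h2 | h2
      · have := h2 j
        simp [defect] at this
        omega
      · simp at h2
        omega
    refine ⟨T, Finset.mem_filter.2 ⟨Finset.mem_powerset.2 (hT.trans hT₀), hne⟩, ?_⟩
    rcases h2 with h2 | h2
    · exact Or.inl ⟨h2, ⟨j, hj⟩, h1, h4⟩
    · exact Or.inr ⟨⟨j, hj⟩, h1, h4, h2⟩
  calc _ ≤ ∑ T ∈ S.powerset.filter Finset.Nonempty, unifProb (EA T ∪ EB T) :=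
        unifProb_le_sum _ _ hcover
    _ ≤ ∑ T ∈ S.powerset.filter Finset.Nonempty,
          Real.exp 5 * (m / (l : ℝ) ^ (k * c) + 1 / (m : ℝ) ^ K)
          * (T.card : ℝ) ^ (3 * K + 5 + 2 * (k * c)) * T.card.factorial / (m : ℝ) ^ T.card := by
        refine Finset.sum_le_sum fun T hT => ?_
        have hne := (Finset.mem_filter.1 hT).2
        refine (unifProb_union_le _ _).trans ((add_le_add (hA T hne) (hB T hne)).trans_eq ?_)
        ring
    _ ≤ ∑ T ∈ S.powerset, Real.exp 5 * (m / (l : ℝ) ^ (k * c) + 1 / (m : ℝ) ^ K)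
          * (T.card : ℝ) ^ (3 * K + 5 + 2 * (k * c)) * T.card.factorial / (m : ℝ) ^ T.card :=
        Finset.sum_le_sum_of_subset_of_nonneg (Finset.filter_subset _ _) fun T _ _ => by positivity
    _ ≤ _ := sum_powerset_le S m _ hm r _ hr0 hr1 hr (by positivity)

/-- The failure probability for the sizes of the tables in the construction. -/
theorem failure_bound {A k s c n m l : ℕ} {ε δ X : ℝ} (hk : 1 ≤ k) (hε : 0 < ε) (hδ0 : 0 < δ)
    (hδ1 : δ < 1) (hc : ((s : ℝ) + 2) / (k * δ) ≤ c) (hn : 1 ≤ n) (hm1 : (1 + ε) * n ≤ m)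
    (hm2 : (m : ℝ) ≤ (1 + ε) * n + A * (n : ℝ) ^ δ) (hl : (n : ℝ) ^ δ ≤ l) (hX : 0 ≤ X) :
    Real.exp 5 * (m / (l : ℝ) ^ (k * c) + 1 / (m : ℝ) ^ (s + 1)) * X
      ≤ Real.exp 5 * (2 + ε + A) * X / (n : ℝ) ^ (s + 1) := by
  have hn' : (1 : ℝ) ≤ n := by exact_mod_cast hn
  have hn0 : (0 : ℝ) < n := by linarith
  have hk' : (0 : ℝ) < k := by exact_mod_cast hk
  have hnm : (n : ℝ) ≤ m := by nlinarith
  have h1 : (n : ℝ) ^ (s + 2) ≤ (l : ℝ) ^ (k * c) := by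
    rw [div_le_iff₀ (by positivity)] at hc
    calc (n : ℝ) ^ (s + 2) = (n : ℝ) ^ ((s : ℝ) + 2) := by
          rw [← Real.rpow_natCast]; push_cast; rfl
      _ ≤ (n : ℝ) ^ (δ * ((k * c : ℕ) : ℝ)) := by
          refine Real.rpow_le_rpow_of_exponent_le hn' ?_
          push_cast
          linarith
      _ = ((n : ℝ) ^ δ) ^ (k * c) := by rw [Real.rpow_mul hn0.le, Real.rpow_natCast]
      _ ≤ _ := pow_le_pow_left₀ (by positivity) hl _
  have h2 : (m : ℝ) ≤ (1 + ε + A) * n := by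
    have h3 : (n : ℝ) ^ δ ≤ n := by
      simpa using Real.rpow_le_rpow_of_exponent_le hn' hδ1.le
    have h4 : (A : ℝ) * (n : ℝ) ^ δ ≤ A * n := by gcongr
    linarith
  have h5 : (m : ℝ) / (l : ℝ) ^ (k * c) ≤ (1 + ε + A) / (n : ℝ) ^ (s + 1) := by
    calc (m : ℝ) / (l : ℝ) ^ (k * c) ≤ (1 + ε + A) * n / (n : ℝ) ^ (s + 2) := by gcongr
      _ = _ := by rw [pow_succ _ (s + 1)]; field_simp
  have h6 : 1 / (m : ℝ) ^ (s + 1) ≤ 1 / (n : ℝ) ^ (s + 1) := by gcongr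
  calc _ ≤ Real.exp 5 * ((1 + ε + A) / (n : ℝ) ^ (s + 1) + 1 / (n : ℝ) ^ (s + 1)) * X := by gcongr
    _ = _ := by field_simp; ring

/-- Outside the event that the pair is bad, the hash function is uniform on `S`. -/
theorem exists_failure_event {A k s c : ℕ} {ε δ : ℝ} (hk : 1 ≤ k) (hε : 0 < ε) (hδ0 : 0 < δ)
    (hδ1 : δ < 1) (hc : ((s : ℝ) + 2) / (k * δ) ≤ c) {U R : Type*} [Finite R] [AddCommGroup R]
    {n m l : ℕ} (hn : 1 ≤ n) (hm1 : (1 + ε) * n ≤ m)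
    (hm2 : (m : ℝ) ≤ (1 + ε) * n + A * (n : ℝ) ^ δ) (hl : (n : ℝ) ^ δ ≤ l)
    {Hm : HashFamily U (Fin m)} {Hl : HashFamily U (Fin l)} {HR : HashFamily U R}
    (hHm : Hm.IsIndependent (2 * k)) (hHl : Hl.IsIndependent (2 * k))
    (hHR : HR.IsIndependent (2 * k)) (S : Finset U) (hS : S.card = n) :
    ∃ B : Set (DSSeed Hm Hl HR c),
      unifProb B ≤ Real.exp 5 * (2 + ε + A)
          * (∑' t : ℕ, (t : ℝ) ^ (3 * (s + 1) + 5 + 2 * (k * c)) * (1 / (1 + ε)) ^ t)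
          / (n : ℝ) ^ (s + 1) ∧
      ∀ v : U → R, unifProb (Bᶜ ∩ {ω | ∀ x ∈ S, ω.hash x = v x})
        = unifProb Bᶜ * (1 / (Nat.card R : ℝ) ^ n) := by
  have hn' : (1 : ℝ) ≤ n := by exact_mod_cast hn
  have hnm : (n : ℝ) ≤ m := by nlinarith
  have hm : 1 ≤ m := by exact_mod_cast hn'.trans hnm
  have hl0 : 1 ≤ l := by
    have := (Real.one_le_rpow hn' hδ0.le).trans hl
    exact_mod_cast this
  have hc1 : 1 ≤ c := by
    have hk' : (0 : ℝ) < k := by exact_mod_cast hk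
    have : (0 : ℝ) < c := lt_of_lt_of_le (by positivity) hc
    exact_mod_cast this
  have : Nonempty (Fin m) := ⟨⟨0, hm⟩⟩
  have : Nonempty (Fin l) := ⟨⟨0, hl0⟩⟩
  refine ⟨{ω | ω.pair.IsBad k S}, ?_, fun v => ?_⟩
  · have h1 : {ω : DSSeed Hm Hl HR c | ω.pair.IsBad k S}
        = DSSeed.equivProd Hm Hl HR ⁻¹' {q | q.1 ∈ {p : PairSeed Hm Hl c | p.IsBad k S}} := rfl
    rw [h1, unifProb_preimage_equiv, unifProb_fst]
    refine (PairSeed.unifProb_isBad_le hk hc1 hm hHm hHl S (1 / (1 + ε)) (by positivity)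
      ((div_lt_one (by positivity)).2 (by linarith)) ?_ (s + 1) (by omega)).trans ?_
    · rw [hS, one_div, ← div_eq_inv_mul, le_div_iff₀ (by positivity)]
      linarith
    · exact failure_bound hk hε hδ0 hδ1 hc hn hm1 hm2 hl (tsum_nonneg fun t => by positivity)
  · rw [← hS]
    exact DSSeed.unifProb_not_isBad_inter hHR S v

/-! ### Memory layout -/

open Finset in
/-- Blocks of fixed sizes, indexed by a finite type, can be stored one after the other. -/
theorem exists_layout {Ω U R ι : Type*} {m : ℕ} (D : ι → Ω → HMem U R m) (nk nv nn : ι → ℕ)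
    (hk : ∀ i ω, (D i ω).keys.length = nk i) (hv : ∀ i ω, (D i ω).vals.length = nv i)
    (hn : ∀ i ω, (D i ω).nums.length = nn i) (I : Finset ι) :
    ∃ store : Ω → HMem U R m,
      (∀ i ∈ I, ∃ bk bv bn, ∀ ω, (store ω).Holds bk bv bn (D i ω)) ∧
      ∀ ω, (store ω).keys.length = ∑ i ∈ I, nk i ∧ (store ω).vals.length = ∑ i ∈ I, nv i ∧
        (store ω).nums.length = ∑ i ∈ I, nn i := by
  classical
  induction I using Finset.induction_on with
  | empty => exact ⟨fun _ => ⟨[], [], []⟩, by simp, by simp⟩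
  | insert i I hi ih =>
    obtain ⟨store, h1, h2⟩ := ih
    refine ⟨fun ω => ⟨(D i ω).keys ++ (store ω).keys, (D i ω).vals ++ (store ω).vals,
      (D i ω).nums ++ (store ω).nums⟩, ?_, fun ω => ?_⟩
    · intro i' hi'
      rcases Finset.mem_insert.1 hi' with rfl | hi'
      · exact ⟨0, 0, 0, fun ω => by simp [HMem.Holds]⟩
      · obtain ⟨bk, bv, bn, h⟩ := h1 i' hi'
        refine ⟨nk i + bk, nv i + bv, nn i + bn, fun ω => ?_⟩
        simp only [HMem.Holds, ← hk i ω, ← hv i ω, ← hn i ω, List.drop_length_add_append]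
        exact h ω
    · simp [sum_insert hi, h2 ω, hk i ω, hv i ω, hn i ω]

/-- Reading an entry of a table that is stored at the address `b`. -/
theorem getElem?_of_ofFn_prefix {α : Type*} {l b : ℕ} {f : Fin l → α} {L : List α}
    (h : List.ofFn f <+: L.drop b) (i : Fin l) : L[b + i.val]? = some (f i) := by
  obtain ⟨r, hr⟩ := h
  rw [← List.getElem?_drop, ← hr, List.getElem?_append_left (by simp)]
  simp

/-! ### The evaluation program -/

section Program

variable {U R Γ : Type*} {m : ℕ}

theorem hrun_append [Add R] (op : Γ → HWord U R → HWord U R → HWord U R) (M : HMem U R m)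
    (p q : List (HInstr U R Γ)) (st : List (HWord U R)) :
    hrun op M (p ++ q) st = (hrun op M p st).bind (hrun op M q) := by
  induction p generalizing st with
  | nil => rfl
  | cons i p ih =>
    simp only [List.cons_append, hrun, Option.bind_assoc]
    congr 1
    funext st'
    exact ih st'

/-- A loop that adds terms to an accumulator on top of the stack. -/
theorem hrun_flatMap_add [Add R] (op : Γ → HWord U R → HWord U R → HWord U R) (M : HMem U R m)
    {ι B : Type*} [AddCommMonoid B] (w : B → HWord U R) (body : ι → List (HInstr U R Γ)) (z : ι → B)
    (st : List (HWord U R)) (h : ∀ j a, hrun op M (body j) (w a :: st) = some (w (a + z j) :: st))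
    (js : List ι) (a : B) :
    hrun op M (js.flatMap body) (w a :: st) = some (w (a + (js.map z).sum) :: st) := by
  induction js generalizing a with
  | nil => simp [hrun]
  | cons j js ih =>
    rw [List.flatMap_cons, hrun_append, h, Option.bind_some, ih, List.map_cons, List.sum_cons,
      add_assoc]

/-- The program for `h_i`: the program `pf` computes `f_i`, the programs `pg j` compute `g_j`, and
the table `z_j` starts at the address `bz j`. The key is expected at depth `q` of the stack. -/
def pairProg (m : ℕ) {c : ℕ} (pf : List (HInstr U R Γ)) (pg : Fin c → List (HInstr U R Γ))
    (bz : Fin c → ℕ) (q : ℕ) : List (HInstr U R Γ) :=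
  .pick q :: (pf ++ (List.finRange c).flatMap fun j =>
    .pick (q + 1) :: (pg j ++ [.loadNum (bz j), .addMod m]))

/-- The program for `h`, given programs for `f_i`, `g_j` and `f`, and the addresses of the tables. -/
def dsProg (m : ℕ) {c : ℕ} (pf : Fin 2 → List (HInstr U R Γ)) (pg : Fin c → List (HInstr U R Γ))
    (pR : List (HInstr U R Γ)) (bz : Fin 2 → Fin c → ℕ) (bt : Fin 2 → ℕ) (ba : Fin c → ℕ) :
    List (HInstr U R Γ) :=
  pairProg m (pf 0) pg (bz 0) 0 ++ (.loadVal (bt 0) :: (pairProg m (pf 1) pg (bz 1) 1 ++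
    (.loadVal (bt 1) :: .addVal :: .pick 1 :: (pR ++ (.addVal ::
      ((List.finRange c).flatMap (fun j => .pick 1 :: (pg j ++ [.loadVal (ba j), .addVal])) ++
        [.swap, .drop]))))))

theorem length_flatMap_finRange_le {α : Type*} {c : ℕ} (f : Fin c → List α) (a : ℕ)
    (h : ∀ j, (f j).length ≤ a) : ((List.finRange c).flatMap f).length ≤ c * a := by
  rw [List.length_flatMap, ← Fin.sum_univ_def]
  exact (Finset.sum_le_card_nsmul _ _ a fun j _ => h j).trans_eq (by simp)

theorem length_pairProg_le {c : ℕ} (pf : List (HInstr U R Γ)) (pg : Fin c → List (HInstr U R Γ))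
    (bz : Fin c → ℕ) (q a : ℕ) (hf : pf.length ≤ a) (hg : ∀ j, (pg j).length ≤ a) :
    (pairProg m pf pg bz q).length ≤ c * (a + 3) + a + 1 := by
  have h := length_flatMap_finRange_le
    (fun j => (.pick (q + 1) :: (pg j ++ [.loadNum (bz j), .addMod m]) : List (HInstr U R Γ)))
    (a + 3) fun j => by
      have := hg j
      simp only [List.length_cons, List.length_append, List.length_nil]
      omega
  simp only [pairProg, List.length_cons, List.length_append]
  omega

theorem length_dsProg_le {c : ℕ} (pf : Fin 2 → List (HInstr U R Γ))
    (pg : Fin c → List (HInstr U R Γ)) (pR : List (HInstr U R Γ)) (bz : Fin 2 → Fin c → ℕ)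
    (bt : Fin 2 → ℕ) (ba : Fin c → ℕ) (a : ℕ) (hf : ∀ i, (pf i).length ≤ a)
    (hg : ∀ j, (pg j).length ≤ a) (hR : pR.length ≤ a) :
    (dsProg m pf pg pR bz bt ba).length ≤ 3 * (c * (a + 3)) + 3 * a + 9 := by
  have h0 := length_pairProg_le (m := m) (pf 0) pg (bz 0) 0 a (hf 0) hg
  have h1 := length_pairProg_le (m := m) (pf 1) pg (bz 1) 1 a (hf 1) hg
  have h := length_flatMap_finRange_le
    (fun j => (.pick 1 :: (pg j ++ [.loadVal (ba j), .addVal]) : List (HInstr U R Γ)))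
    (a + 3) fun j => by
      have := hg j
      simp only [List.length_cons, List.length_append, List.length_nil]
      omega
  simp only [dsProg, List.length_cons, List.length_append, List.length_nil]
  omega

theorem hrun_pairProg [Add R] [NeZero m] {l c : ℕ} {Hm : HashFamily U (Fin m)}
    {Hl : HashFamily U (Fin l)} (op : Γ → HWord U R → HWord U R → HWord U R) (M : HMem U R m)
    (p : PairSeed Hm Hl c) (i : Fin 2) (x : U) (pf : List (HInstr U R Γ))
    (pg : Fin c → List (HInstr U R Γ)) (bz : Fin c → ℕ) (q : ℕ)
    (hf : ∀ st, hrun op M pf (.key x :: st) = some (.num (Hm.fn (p.f i) x).val :: st))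
    (hg : ∀ j st, hrun op M (pg j) (.key x :: st) = some (.num (Hl.fn (p.g j) x).val :: st))
    (hz : ∀ j (b : Fin l), M.nums[bz j + b.val]? = some (p.z i j b))
    (st : List (HWord U R)) (hst : st[q]? = some (.key x)) :
    hrun op M (pairProg m pf pg bz q) st = some (.num (p.hash i x).val :: st) := by
  have hbody : ∀ j (a : Fin m),
      hrun op M (.pick (q + 1) :: (pg j ++ [.loadNum (bz j), .addMod m])) (.num a.val :: st)
        = some (.num (a + p.z i j (Hl.fn (p.g j) x)).val :: st) := by
    intro j a
    simp [hrun, HInstr.step, hst, hrun_append, hg, hz, Fin.val_add]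
  have hloop := hrun_flatMap_add op M (fun a : Fin m => HWord.num a.val) _ _ st hbody
    (List.finRange c) (Hm.fn (p.f i) x)
  rw [← Fin.sum_univ_def, ← p.hash_eq] at hloop
  simp only [pairProg, hrun, HInstr.step, hst, Option.map_some, Option.bind_some, hrun_append, hf]
  exact hloop

theorem hrun_dsProg [AddCommGroup R] [NeZero m] {l c : ℕ} {Hm : HashFamily U (Fin m)}
    {Hl : HashFamily U (Fin l)} {HR : HashFamily U R}
    (op : Γ → HWord U R → HWord U R → HWord U R) (M : HMem U R m) (ω : DSSeed Hm Hl HR c) (x : U)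
    (pf : Fin 2 → List (HInstr U R Γ)) (pg : Fin c → List (HInstr U R Γ))
    (pR : List (HInstr U R Γ)) (bz : Fin 2 → Fin c → ℕ) (bt : Fin 2 → ℕ) (ba : Fin c → ℕ)
    (hf : ∀ i st, hrun op M (pf i) (.key x :: st) = some (.num (Hm.fn (ω.pair.f i) x).val :: st))
    (hg : ∀ j st, hrun op M (pg j) (.key x :: st) = some (.num (Hl.fn (ω.pair.g j) x).val :: st))
    (hR : ∀ st, hrun op M pR (.key x :: st) = some (.val (HR.fn ω.f x) :: st))
    (hz : ∀ i j (b : Fin l), M.nums[bz i j + b.val]? = some (ω.pair.z i j b))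
    (ht : ∀ i (b : Fin m), M.vals[bt i + b.val]? = some (ω.t i b))
    (hy : ∀ j (b : Fin l), M.vals[ba j + b.val]? = some (ω.y j b)) :
    hrun op M (dsProg m pf pg pR bz bt ba) [.key x] = some [.val (ω.hash x)] := by
  have h0 := hrun_pairProg op M ω.pair 0 x (pf 0) pg (bz 0) 0 (hf 0) hg (hz 0) [.key x] rfl
  have h1 := hrun_pairProg op M ω.pair 1 x (pf 1) pg (bz 1) 1 (hf 1) hg (hz 1)
    [.val (ω.t 0 (ω.pair.hash 0 x)), .key x] rfl
  have hbody : ∀ j (a : R),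
      hrun op M (.pick 1 :: (pg j ++ [.loadVal (ba j), .addVal])) [.val a, .key x]
        = some [.val (a + ω.y j (Hl.fn (ω.pair.g j) x)), .key x] := by
    intro j a
    simp [hrun, HInstr.step, hrun_append, hg, hy]
  have hloop := hrun_flatMap_add op M (fun a : R => HWord.val a) _ _ [.key x] hbody
    (List.finRange c)
  simp only [← Fin.sum_univ_def] at hloop
  simp only [dsProg, hrun_append, h0, Option.bind_some, hrun, HInstr.step, ht, Option.map_some, h1]
  simp [hrun_append, hR, hrun, HInstr.step, hloop, DSSeed.hash]

end Program

/-- Storage of the data structure: the descriptions of the `c + 3` hash functions, the tables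
`t_1`, `t_2` of length `m`, and the `3c` tables `z_j`, `y_j` of length `l`. -/
theorem exists_store_and_program {U R Γ : Type*} [AddCommGroup R] {m l c a : ℕ} [NeZero m]
    {Hm : HashFamily U (Fin m)} {Hl : HashFamily U (Fin l)} {HR : HashFamily U R}
    (op : Γ → HWord U R → HWord U R → HWord U R)
    (hm : Hm.HasCost m op (fun i => HWord.num i.val) a)
    (hl : Hl.HasCost m op (fun i => HWord.num i.val) a)
    (hR : HR.HasCost m op HWord.val a) :
    ∃ (store : DSSeed Hm Hl HR c → HMem U R m) (prog : List (HInstr U R Γ)),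
      prog.length ≤ 3 * (c * (a + 3)) + 3 * a + 9 ∧
      (∀ ω x, hrun op (store ω) prog [.key x] = some [.val (ω.hash x)]) ∧
      ∀ ω, (store ω).vals.length + (store ω).nums.length ≤ 2 * m + 3 * (c * l) + (c + 3) * a ∧
        (store ω).keys.length ≤ (c + 3) * a := by
  obtain ⟨nkm, nvm, nnm, descm, progm, hsm, hlm, hcm⟩ := hm
  obtain ⟨nkl, nvl, nnl, descl, progl, hsl, hll, hcl⟩ := hl
  obtain ⟨nkR, nvR, nnR, descR, progR, hsR, hlR, hcR⟩ := hR
  let D : (Fin 2 ⊕ Fin c ⊕ Unit) ⊕ (Fin 2 ⊕ (Fin 2 × Fin c) ⊕ Fin c) →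
      DSSeed Hm Hl HR c → HMem U R m :=
    Sum.elim
      (Sum.elim (fun i ω => descm (ω.pair.f i))
        (Sum.elim (fun j ω => descl (ω.pair.g j)) (fun _ ω => descR ω.f)))
      (Sum.elim (fun i ω => ⟨[], List.ofFn (ω.t i), []⟩)
        (Sum.elim (fun q ω => ⟨[], [], List.ofFn (ω.pair.z q.1 q.2)⟩)
          (fun j ω => ⟨[], List.ofFn (ω.y j), []⟩)))
  obtain ⟨store, hstore, hlen⟩ := exists_layout D
    (Sum.elim (Sum.elim (fun _ => nkm) (Sum.elim (fun _ => nkl) fun _ => nkR))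
      (Sum.elim (fun _ => 0) (Sum.elim (fun _ => 0) fun _ => 0)))
    (Sum.elim (Sum.elim (fun _ => nvm) (Sum.elim (fun _ => nvl) fun _ => nvR))
      (Sum.elim (fun _ => m) (Sum.elim (fun _ => 0) fun _ => l)))
    (Sum.elim (Sum.elim (fun _ => nnm) (Sum.elim (fun _ => nnl) fun _ => nnR))
      (Sum.elim (fun _ => 0) (Sum.elim (fun _ => l) fun _ => 0)))
    (by rintro ((i | j | _) | (i | q | j)) ω <;> simp [D, hlm, hll, hlR])
    (by rintro ((i | j | _) | (i | q | j)) ω <;> simp [D, hlm, hll, hlR])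
    (by rintro ((i | j | _) | (i | q | j)) ω <;> simp [D, hlm, hll, hlR])
    Finset.univ
  choose bk bv bn hb using fun i => hstore i (Finset.mem_univ i)
  refine ⟨store, dsProg m
    (fun i => progm (bk (.inl (.inl i))) (bv (.inl (.inl i))) (bn (.inl (.inl i))))
    (fun j => progl (bk (.inl (.inr (.inl j)))) (bv (.inl (.inr (.inl j))))
      (bn (.inl (.inr (.inl j)))))
    (progR (bk (.inl (.inr (.inr ())))) (bv (.inl (.inr (.inr ()))))
      (bn (.inl (.inr (.inr ())))))
    (fun i j => bn (.inr (.inr (.inl (i, j))))) (fun i => bv (.inr (.inl i)))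
    (fun j => bv (.inr (.inr (.inr j)))), ?_, fun ω x => ?_, fun ω => ?_⟩
  · exact length_dsProg_le _ _ _ _ _ _ a (fun i => (hcm _ _ _).1) (fun j => (hcl _ _ _).1)
      (hcR _ _ _).1
  · refine hrun_dsProg op _ ω x _ _ _ _ _ _ ?_ ?_ ?_ ?_ ?_ ?_
    · exact fun i st => (hcm _ _ _).2 _ _ (hb (.inl (.inl i)) ω) x st
    · exact fun j st => (hcl _ _ _).2 _ _ (hb (.inl (.inr (.inl j))) ω) x st
    · exact fun st => (hcR _ _ _).2 _ _ (hb (.inl (.inr (.inr ()))) ω) x st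
    · exact fun i j b => getElem?_of_ofFn_prefix (hb (.inr (.inr (.inl (i, j)))) ω).2.2 b
    · exact fun i b => getElem?_of_ofFn_prefix (hb (.inr (.inl i)) ω).2.1 b
    · exact fun j b => getElem?_of_ofFn_prefix (hb (.inr (.inr (.inr j))) ω).2.1 b
  · obtain ⟨h1, h2, h3⟩ := hlen ω
    rw [h1, h2, h3]
    simp only [Fintype.sum_sum_type, Sum.elim_inl, Sum.elim_inr, Finset.sum_const,
      Finset.card_univ, Fintype.card_fin, Fintype.card_prod, Fintype.card_unit, smul_eq_mul]
    constructor
    · have e1 : c * (nvl + nnl) ≤ c * a := Nat.mul_le_mul_left c (by omega)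
      nlinarith
    · have e1 : c * nkl ≤ c * a := Nat.mul_le_mul_left c (by omega)
      nlinarith

/-! ### The theorem -/

theorem theorem2 (A k : ℕ) (hk : 1 ≤ k) :
    -- implied constant of the evaluation time
    ∃ Ctime : ℝ, ∀ δ : ℝ, 0 < δ → δ < 1 →
    -- implied constant of the space bounds
    ∃ Cspace : ℝ, ∀ (ε : ℝ) (s c : ℕ), 0 < ε →
    ((s : ℝ) + 2) / (k * δ) ≤ c → (c : ℝ) ≤ A * (s + 1) / δ →
    -- implied constant of the failure probability
    ∃ Cprob : ℝ, ∀ (U : Type u) (R : Type v) [Fintype U] [Fintype R] [AddCommGroup R]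
      (n m l : ℕ), 1 ≤ n →
      (1 + ε) * n ≤ m → (m : ℝ) ≤ (1 + ε) * n + A * (n : ℝ) ^ δ →
      (n : ℝ) ^ δ ≤ l → (l : ℝ) ≤ A * (n : ℝ) ^ δ →
      ∀ (Hm : HashFamily.{u, 0, w₁} U (Fin m)) (Hl : HashFamily.{u, 0, w₂} U (Fin l))
        (HR : HashFamily.{u, v, w₃} U R),
      Hm.IsIndependent (2 * k) → Hl.IsIndependent (2 * k) → HR.IsIndependent (2 * k) →
      -- (i) outside an event of small probability, `h` is uniform on `S`
      (∀ S : Finset U, S.card = n →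
        ∃ B : Set (DSSeed Hm Hl HR c),
          unifProb B ≤ Cprob / (n : ℝ) ^ (s + 1) ∧
          ∀ v : U → R,
            unifProb (Bᶜ ∩ {ω | ∀ x ∈ S, ω.hash x = v x})
              = unifProb Bᶜ * (1 / (Fintype.card R : ℝ) ^ n)) ∧
      -- (ii), (iii) a representation in memory and an evaluation program, if the members of the
      -- hash families are given by `O(k)` words and evaluated in `O(k)` steps
      (∀ (Γ : Type w₄) (op : Γ → HWord U R → HWord U R → HWord U R),
        Hm.HasCost m op (fun i => HWord.num i.val) (A * (2 * k)) →
        Hl.HasCost m op (fun i => HWord.num i.val) (A * (2 * k)) →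
        HR.HasCost m op HWord.val (A * (2 * k)) →
        ∃ (store : DSSeed Hm Hl HR c → HMem U R m) (prog : List (HInstr U R Γ)),
          (prog.length : ℝ) ≤ Ctime * ((s + 1) / δ) ∧
          (∀ ω x, hrun op (store ω) prog [.key x] = some [.val (ω.hash x)]) ∧
          ∀ ω,
            (((store ω).vals.length + (store ω).nums.length : ℕ) : ℝ)
                ≤ 2 * (1 + ε) * n + Cspace * ((s + 1) * (n : ℝ) ^ δ) ∧
            ((store ω).keys.length : ℝ) ≤ Cspace * (s + 1)) := by
  let a : ℕ := A * (2 * k)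
  refine ⟨3 * A * (a + 3) + 3 * a + 9, fun δ hδ0 hδ1 =>
    ⟨2 * A + 3 * A ^ 2 / δ + A * a / δ + 3 * a, fun ε s c hε hc1 hc2 =>
    ⟨Real.exp 5 * (2 + ε + A)
      * (∑' t : ℕ, (t : ℝ) ^ (3 * (s + 1) + 5 + 2 * (k * c)) * (1 / (1 + ε)) ^ t),
    fun U R _ _ _ n m l hn hm1 hm2 hl1 hl2 Hm Hl HR hHm hHl hHR => ⟨fun S hS => ?_,
      fun Γ op hcm hcl hcR => ?_⟩⟩⟩⟩
  · obtain ⟨B, hB, hv⟩ := exists_failure_event hk hε hδ0 hδ1 hc1 hn hm1 hm2 hl1 hHm hHl hHR S hS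
    rw [Nat.card_eq_fintype_card] at hv
    exact ⟨B, hB, hv⟩
  have hn' : (1 : ℝ) ≤ n := by exact_mod_cast hn
  have hm0 : 0 < m := by
    have : (0 : ℝ) < m := lt_of_lt_of_le (by positivity) hm1
    exact_mod_cast this
  have : NeZero m := ⟨hm0.ne'⟩
  obtain ⟨store, prog, hlen, heval, hsize⟩ := exists_store_and_program (c := c) op hcm hcl hcR
  have hs1 : (1 : ℝ) ≤ s + 1 := by linarith [(Nat.cast_nonneg s : (0 : ℝ) ≤ s)]
  have hsδ : (1 : ℝ) ≤ (s + 1) / δ := by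
    rw [le_div_iff₀ hδ0]; linarith
  refine ⟨store, prog, ?_, heval, fun ω => ⟨?_, ?_⟩⟩
  · have h1 : (prog.length : ℝ) ≤ 3 * (c * (a + 3)) + 3 * a + 9 := by exact_mod_cast hlen
    calc (prog.length : ℝ) ≤ 3 * (c * (a + 3)) + (3 * a + 9) * 1 := by linarith
      _ ≤ 3 * (A * (s + 1) / δ * (a + 3)) + (3 * a + 9) * ((s + 1) / δ) := by gcongr
      _ = _ := by ring
  · have h1 : (((store ω).vals.length + (store ω).nums.length : ℕ) : ℝ)
        ≤ 2 * m + 3 * (c * l) + (c + 3) * a := by exact_mod_cast (hsize ω).1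
    have hX1 : (1 : ℝ) ≤ (n : ℝ) ^ δ := Real.one_le_rpow hn' hδ0.le
    have hX : (1 : ℝ) * (n : ℝ) ^ δ ≤ (s + 1) * (n : ℝ) ^ δ := by gcongr
    have hY : ((s : ℝ) + 1) * 1 ≤ (s + 1) * (n : ℝ) ^ δ := by gcongr
    calc _ ≤ 2 * (m : ℝ) + 3 * (c * l) + (c + 3 * 1) * a := by linarith
      _ ≤ 2 * ((1 + ε) * n + A * (1 * (n : ℝ) ^ δ)) + 3 * (A * (s + 1) / δ * (A * (n : ℝ) ^ δ))
          + (A * ((s + 1) * 1) / δ + 3 * (1 * (n : ℝ) ^ δ)) * a := by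
        have hl2' : (l : ℝ) ≤ A * (n : ℝ) ^ δ := hl2
        gcongr
        · rw [one_mul]; exact hm2
        · rw [mul_one]; exact hc2
        · rw [one_mul]; exact hX1
      _ ≤ 2 * ((1 + ε) * n + A * ((s + 1) * (n : ℝ) ^ δ))
          + 3 * (A * (s + 1) / δ * (A * (n : ℝ) ^ δ))
          + (A * ((s + 1) * (n : ℝ) ^ δ) / δ + 3 * ((s + 1) * (n : ℝ) ^ δ)) * a := by gcongr
      _ = _ := by ring
  · have h1 : ((store ω).keys.length : ℝ) ≤ (c + 3) * a := by exact_mod_cast (hsize ω).2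
    calc _ ≤ ((c : ℝ) + 3 * 1) * a := by linarith
      _ ≤ (A * (s + 1) / δ + 3 * (s + 1)) * a := by gcongr
      _ = (A * a / δ + 3 * a) * (s + 1) := by ring
      _ ≤ _ := by
        gcongr
        have : (0 : ℝ) ≤ 2 * A + 3 * A ^ 2 / δ := by positivity
        linarith
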